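/- Let $(X,d)$ be a compact metric space with base point $x_0\in X$, let $P(X)$ be the set of Borel probability measures on $X$, let $\mu,\nu\in P(X)$, $\lambda>0$ and $\alpha\ge 1$. Let $\phi:\mathbb R\to\overline{\mathbb R}$ be proper, convex and lower semicontinuous, with $\phi(1)=0$, with $1$ in the relative interior of $\operatorname{dom}\phi=\{x:\phi(x)<\infty\}$, and strictly convex at $1$, i.e. $\phi(1)<t\phi(x_1)+(1-t)\phi(x_2)$ whenever $t\in(0,1)$, $x_1,x_2\in\operatorname{dom}\phi$, $tx_1+(1-t)x_2=1$ and not $x_1=x_2=1$. For $\xi\in P(X)$ with Lebesgue decomposition $\xi=\xi_c+\xi_s$, $\xi_c\ll\nu$, $\xi_s\perp\nu$, put $$D_\phi(\xi\Vert\nu)=\int\phi\Big(\frac{d\xi_c}{d\nu}\Big)\,d\nu+\phi'(\infty)\,\xi_s(X)\in(-\infty,\infty],\qquad \phi'(\infty)=\lim_{x\to\infty}\frac{\phi(x)}{x},$$ with $\infty\cdot 0=0$. Let $W_1(\mu,\xi)=\inf_\pi\int d(x_1,x_2)\,d\pi(x_1,x_2)$, the infimum being over the probability measures $\pi$ on $X\times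 X$ with marginals $\mu$ and $\xi$. Let $Lip(X,x_0)$ be the set of Lipschitz functions $f:X\to\mathbb R$ with $f(x_0)=0$, let $\Vert f\Vert_L=\sup_{x\ne y}\frac{|f(x)-f(y)|}{d(x,y)}$ (read as $0$ if $X$ has one point), and let $$D_\phi^*(f\Vert\nu)=\sup_{\xi\in P(X)}\Big\{\int f\,d\xi-D_\phi(\xi\Vert\nu)\Big\}.$$ Then the infimum $$D_{\phi,\lambda,\alpha}(\mu\Vert\nu)=\inf_{\xi\in P(X)}\big\{D_\phi(\xi\Vert\nu)+\lambda W_1(\mu,\xi)^\alpha\big\}$$ is attained. If $\alpha=1$, then $$D_{\phi,\lambda,1}(\mu\Vert\nu)=\max_{f\in Lip(X,x_0),\ \Vert f\Vert_L\le\lambda}\Big\{\int f\,d\mu-D_\phi^*(f\Vert\nu)\Big\},$$ and if $\alpha>1$, then $$D_{\phi,\lambda,\alpha}(\mu\Vert\nu)=\max_{f\in Lip(X,x_0)}\Big\{\int f\,d\mu-D_\phi^*(f\Vert\nu)-(\alpha-1)\,\alpha^{\frac{\alpha}{1-\alpha}}\,\lambda^{\frac{1}{1-\alpha}}\,\Vert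 f\Vert_L^{\frac{\alpha}{\alpha-1}}\Big\};$$ in both cases the maximum is attained. -/

import Mathlib

open MeasureTheory Filter
open scoped ENNReal

noncomputable section

namespace MoreauYosida

/-- The effective domain of an extended real-valued function. -/
def dom (φ : ℝ → EReal) : Set ℝ := {x | φ x < ⊤}

/-- A proper, convex and lower semicontinuous function `φ : ℝ → [-∞, ∞]`, strictly convex at `1`,
with `φ 1 = 0` and `1` in the relative interior of its effective domain.
In `EReal`, `0 * ⊤ = 0`; as `φ` never takes the value `⊥`, no sum `⊤ + ⊥` occurs below. -/
structure IsAdmissible (φ : ℝ → EReal) : Prop where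
  dom_nonempty : (dom φ).Nonempty
  ne_bot : ∀ x, φ x ≠ ⊥
  convex : ∀ x y t : ℝ, 0 ≤ t → t ≤ 1 →
    φ (t * x + (1 - t) * y) ≤ (t : EReal) * φ x + ((1 - t : ℝ) : EReal) * φ y
  lowerSemicontinuous : LowerSemicontinuous φ
  strictConvexAt_one : ∀ x₁ ∈ dom φ, ∀ x₂ ∈ dom φ, ∀ t : ℝ, 0 < t → t < 1 →
    t * x₁ + (1 - t) * x₂ = 1 → ¬ (x₁ = 1 ∧ x₂ = 1) →
    φ 1 < (t : EReal) * φ x₁ + ((1 - t : ℝ) : EReal) * φ x₂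
  map_one : φ 1 = 0
  one_mem_relint : (1 : ℝ) ∈ intrinsicInterior ℝ (dom φ)

/-- `φ'(∞) = lim_{x → ∞} φ(x) / x`. For proper convex `φ` the limit exists in `[-∞, ∞]`,
and the lower limit is then the limit. -/
def slopeAtTop (φ : ℝ → EReal) : EReal :=
  liminf (fun x : ℝ => φ x / (x : EReal)) atTop

variable {X : Type*} [MeasurableSpace X]

/-- The integral of an extended real-valued function, as the integral of its positive part minus
the integral of its negative part (meaningful when one of the two is finite). -/
def eintegral (ν : Measure X) (g : X → EReal) : EReal :=
  ((∫⁻ x, (g x).toENNReal ∂ν : ℝ≥0∞) : EReal) - ((∫⁻ x, (-g x).toENNReal ∂ν : ℝ≥0∞) : EReal)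

/-- The `f`-divergence `D_φ(μ‖ν) = ∫ φ(dμ_c/dν) dν + φ'(∞) μ_s(X)` of nonnegative measures, where
`μ = μ_c + μ_s` is the Lebesgue decomposition of `μ` with respect to `ν` (the singular part of a
nonnegative `μ` has no negative part). In `EReal`, `⊤ * 0 = 0`. -/
def fDiv (φ : ℝ → EReal) (μ ν : Measure X) : EReal :=
  eintegral ν (fun x => φ (μ.rnDeriv ν x).toReal) +
    slopeAtTop φ * ((μ.singularPart ν Set.univ : ℝ≥0∞) : EReal)

/-- The tight convex conjugate `D_φ^*(f‖ν) = sup_{ξ ∈ P(X)} {∫ f dξ - D_φ(ξ‖ν)}`. -/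
def fDivConj (φ : ℝ → EReal) (f : X → ℝ) (ν : Measure X) : EReal :=
  ⨆ ξ : ProbabilityMeasure X,
    ((∫ x, f x ∂(ξ : Measure X) : ℝ) : EReal) - fDiv φ (ξ : Measure X) ν

/-- The couplings of `μ` and `ν`: the measures on `X × X` with marginals `μ` and `ν`. -/
def couplings (μ ν : Measure X) : Set (Measure (X × X)) :=
  {π | π.map Prod.fst = μ ∧ π.map Prod.snd = ν}

variable [MetricSpace X]

/-- The Wasserstein-1 distance `W₁(μ, ν) = inf_π ∫ d(x₁, x₂) dπ(x₁, x₂)`. -/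
def W₁ (μ ν : Measure X) : ℝ≥0∞ :=
  ⨅ π ∈ couplings μ ν, ∫⁻ p, edist p.1 p.2 ∂π

/-- The function `ξ ↦ D_φ(ξ‖ν) + λ W₁(μ, ξ)^α` on `P(X)`. -/
def primalObjective (φ : ℝ → EReal) (lam α : ℝ) (μ ν : Measure X) (ξ : ProbabilityMeasure X) :
    EReal :=
  fDiv φ (ξ : Measure X) ν + ((ENNReal.ofReal lam * W₁ μ (ξ : Measure X) ^ α : ℝ≥0∞) : EReal)

/-- The Moreau-Yosida approximation `D_{φ,λ,α}(μ‖ν) = inf_{ξ ∈ P(X)} {D_φ(ξ‖ν) + λ W₁(μ, ξ)^α}`. -/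
def myDiv (φ : ℝ → EReal) (lam α : ℝ) (μ ν : Measure X) : EReal :=
  ⨅ ξ : ProbabilityMeasure X, primalObjective φ lam α μ ν ξ

end MoreauYosida

namespace MoreauYosida

/-- The space `Lip(X, x₀)` of Lipschitz continuous functions vanishing at `x₀`. -/
def LipAt {X : Type*} [MetricSpace X] (x₀ : X) : Set (X → ℝ) :=
  {f | (∃ K : NNReal, LipschitzWith K f) ∧ f x₀ = 0}

/-- The Lipschitz norm `‖f‖_L = sup_{x ≠ y} |f x - f y| / d(x, y)` of a Lipschitz function
(`0` on a one-point space, where the supremum is over the empty set). -/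
def lipNorm {X : Type*} [MetricSpace X] (f : X → ℝ) : ℝ :=
  sSup {r : ℝ | ∃ x y : X, x ≠ y ∧ r = |f x - f y| / dist x y}

end MoreauYosida

end

/-! The primal problem is lifted to the probability measures `π` on `X × X` with first marginal `μ`:
minimise `D_φ(π₂‖ν) + λ (∫ d dπ)^α`, where `π₂` is the second marginal. This set is weakly compact,
so a minimiser exists once `D_φ(·‖ν)` is lower semicontinuous.

Every term is then written as a supremum. `D_φ(ξ‖ν)` is the supremum of `∫ h dξ - ∫ ψ dν` over
continuous `h`, `ψ` with `h(x) t - ψ(x) ≤ φ(t)` for all `x` and all `t ≥ 0`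
(`coe_integral_sub_integral_le_fDiv`, `exists_dualPairs_gt`). The penalty is `λ w^α = max_r (r w -
N(r))` (`IsConjugatePenalty`), and a continuous `k` is a multiplier for the marginal constraint. The
Lagrangian `∫ (h(y) + r d(x,y) - k(x)) dπ + ∫ k dμ - ∫ ψ dν - N(r)` is affine and weakly continuous
in `π` and concave in the multipliers. The minimax principle on the compact space of all `π`
therefore gives, for each `c` below the primal value, multipliers for which it is at least `c` at
every `π`.

Dirac masses turn this into a pointwise inequality between `k(x)` and `h(y) + r d(x,y)`. The
inf-convolution `g(x) = inf_y (h(y) + r d(x,y))` is `r`-Lipschitz and can replace both `h` and `k`,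
which leaves `c + ∫ g dξ - ∫ g dμ + N(r) ≤ D_φ(ξ‖ν)` for all `ξ`: the dual value at `g` is at least
`c`. A bound on `r` and Arzelà-Ascoli let `c` rise to the primal value, so the dual maximum is
attained. Weak duality follows by integrating the Lipschitz bound against a coupling and using `r w
- N(r) ≤ λ w^α`. -/

noncomputable section

namespace MoreauYosida

/-! ### Minimax principle. -/

/-- A minimax principle on a compact space `K` in which mixtures exist: if no point of `K` keeps
all the functions `F · i` below `c`, then a single one of them is at least `c` everywhere. -/
theorem exists_forall_le_of_forall_exists_lt {K V : Type*} [TopologicalSpace K] [CompactSpace K]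
    [Nonempty K] [AddCommGroup V] [Module ℝ V] {S : Set V} {F : K → V → ℝ}
    (hcont : ∀ i ∈ S, Continuous fun x => F x i)
    (hmix : ∀ x y : K, ∀ t : ℝ, 0 ≤ t → t ≤ 1 → ∃ z, ∀ i, F z i = t * F x i + (1 - t) * F y i)
    (hconc : ∀ x, ConcaveOn ℝ S (F x)) {c : ℝ} (h : ∀ x, ∃ i ∈ S, c < F x i) :
    ∃ j ∈ S, ∀ x, c ≤ F x j := by
  classical
  obtain ⟨s, hs⟩ := isCompact_univ.elim_finite_subcover (fun i : S => {x | c < F x i})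
    (fun i => isOpen_lt continuous_const (hcont i i.2))
    (fun x _ => by
      obtain ⟨i, hi, hx⟩ := h x
      exact Set.mem_iUnion.2 ⟨⟨i, hi⟩, hx⟩)
  have hs' : ∀ x, ∃ i : s, c < F x i := fun x => by
    have := hs (Set.mem_univ x)
    simp only [Set.mem_iUnion] at this
    obtain ⟨i, hi, hx⟩ := this
    exact ⟨⟨i, hi⟩, hx⟩
  -- `B` is the set of vectors strictly above some profile `(F x i - c)_i`. It is open, convex
  -- because of mixtures, and upward closed. It misses `0` because the finite subfamily `s` already
  -- exceeds `c` somewhere at each `x`.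
  let B : Set (s → ℝ) := {v | ∃ x, ∀ i : s, F x i < v i + c}
  have hBconv : Convex ℝ B := by
    rintro v ⟨x, hx⟩ w ⟨y, hy⟩ a b ha hb hab
    obtain ⟨z, hz⟩ := hmix x y a ha (by linarith)
    refine ⟨z, fun i => ?_⟩
    have hb' : b = 1 - a := by linarith
    subst hb'
    simp only [hz, Pi.add_apply, Pi.smul_apply, smul_eq_mul]
    have h1 := hx i
    have h2 := hy i
    rcases ha.eq_or_lt with h0 | h0
    · subst h0; linarith
    · nlinarith [mul_lt_mul_of_pos_left h1 h0, mul_le_mul_of_nonneg_left h2.le hb]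
  have hBopen : IsOpen B := by
    have : B = ⋃ x, ⋂ i : s, {v : s → ℝ | F x i < v i + c} := by
      ext v; simp [B]
    rw [this]
    exact isOpen_iUnion fun x => isOpen_iInter_of_finite fun i =>
      isOpen_lt continuous_const ((continuous_apply i).add continuous_const)
  have h0 : (0 : s → ℝ) ∉ B := by
    rintro ⟨x, hx⟩
    obtain ⟨i, hi⟩ := hs' x
    have := hx i
    simp only [Pi.zero_apply, zero_add] at this
    exact absurd hi (not_lt.2 this.le)
  obtain ⟨f, hf⟩ := geometric_hahn_banach_point_open hBconv hBopen h0
  rw [map_zero] at hf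
  let w : s → ℝ := fun i => f (Pi.single i 1)
  have hfw : ∀ v, f v = ∑ i, w i * v i := fun v => by
    conv_lhs => rw [← Finset.univ_sum_single v]
    rw [map_sum]
    refine Finset.sum_congr rfl fun i _ => ?_
    have : Pi.single i (v i) = v i • (Pi.single i (1 : ℝ) : s → ℝ) := by
      rw [← Pi.single_smul]; simp
    rw [this, map_smul, smul_eq_mul, mul_comm]
  have hB : ∀ x, ∀ ε > 0, 0 < ∑ i, w i * (F x i - c + ε) := fun x ε hε => by
    rw [← hfw fun i => F x i - c + ε]
    exact hf _ ⟨x, fun i => by simp only; linarith⟩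
  have x₀ : K := Classical.arbitrary K
  have hw : ∀ i, 0 ≤ w i := fun i => by
    by_contra! hneg
    let v : s → ℝ := fun i => F x₀ i - c + 1
    have hmem : ∀ t : ℝ, 0 ≤ t → 0 < f v + t * w i := fun t ht => by
      have : f (v + t • Pi.single i 1) = f v + t * w i := by
        rw [map_add, map_smul, smul_eq_mul]
      rw [← this]
      refine hf _ ⟨x₀, fun j => ?_⟩
      have : 0 ≤ t * (Pi.single i (1 : ℝ) : s → ℝ) j := by
        refine mul_nonneg ht ?_
        by_cases hj : j = i
        · subst hj; simp
        · simp [hj]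
      simp only [Pi.add_apply, Pi.smul_apply, smul_eq_mul, v]
      linarith
    have hv : 0 < f v := by simpa using hmem 0 le_rfl
    -- Since `B` is upward closed, adding multiples of the `i`-th basis vector stays in `B`; at this
    -- multiple a negative weight would bring the functional down to `0`.
    have := hmem (f v / -w i) (div_nonneg hv.le (by linarith))
    have hne : w i ≠ 0 := hneg.ne
    have h2 : f v / -w i * w i = - f v := by field_simp
    linarith
  have hW : 0 < ∑ i, w i := by
    refine (Finset.sum_nonneg fun i _ => hw i).lt_of_ne fun h => ?_
    have hz := (Finset.sum_eq_zero_iff_of_nonneg fun i _ => hw i).1 h.symm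
    have := hB x₀ 1 one_pos
    rw [Finset.sum_eq_zero fun i hi => by rw [hz i hi, zero_mul]] at this
    exact lt_irrefl _ this
  have hge : ∀ x, c * ∑ i, w i ≤ ∑ i, w i * F x i := fun x => by
    refine le_of_forall_pos_le_add fun ε hε => ?_
    have := hB x (ε / ∑ i, w i) (div_pos hε hW)
    have h2 : ∑ i, w i * (F x i - c + ε / ∑ i, w i)
        = ∑ i, w i * F x i - c * ∑ i, w i + ε := by
      have h3 : ∀ i, w i * (F x i - c + ε / ∑ i, w i)
          = w i * F x i - c * w i + w i * (ε / ∑ i, w i) := fun i => by ring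
      simp_rw [h3]
      rw [Finset.sum_add_distrib, Finset.sum_sub_distrib, ← Finset.mul_sum, ← Finset.sum_mul,
        mul_div_cancel₀ _ hW.ne']
    linarith
  let W := ∑ i, w i
  have h1 : ∑ i, w i / W = 1 := by rw [← Finset.sum_div, div_self hW.ne']
  have hnn : ∀ i ∈ Finset.univ, 0 ≤ w i / W := fun i _ => div_nonneg (hw i) hW.le
  -- The normalised separating weights average the finitely many indices into one, and concavity
  -- carries the averaged bound over to it.
  refine ⟨∑ i, (w i / W) • (i : V), (hconc x₀).1.sum_mem hnn h1 fun i _ => i.1.2, fun x => ?_⟩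
  refine le_trans ?_ ((hconc x).le_map_sum hnn h1 fun i _ => i.1.2)
  have : ∑ i, (w i / W) • F x i = (∑ i, w i * F x i) / W := by
    rw [Finset.sum_div]
    exact Finset.sum_congr rfl fun i _ => by simp [div_mul_eq_mul_div]
  rw [this, le_div_iff₀ hW]
  exact hge x

/-! ### Affine minorants of `φ` and its recession slope. -/

/-- The pairs `(a, b)` such that `t ↦ a t - b` minorizes `φ` on `[0, ∞)`. -/
def affineMinorants (φ : ℝ → EReal) : Set (ℝ × ℝ) :=
  {p | ∀ t : ℝ, 0 ≤ t → ((p.1 * t - p.2 : ℝ) : EReal) ≤ φ t}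

theorem le_of_forall_real_le {x : ℝ} {y : EReal} (hy : ∀ r : ℝ, y ≤ r → x ≤ r) :
    (x : EReal) ≤ y := by
  refine EReal.le_of_forall_lt_iff_le.1 fun z hz => ?_
  exact_mod_cast hy z hz.le

/-- Testing against real upper bounds of `φ t` reduces later arguments to real linear arithmetic. -/
theorem mem_affineMinorants_iff {φ : ℝ → EReal} {p : ℝ × ℝ} :
    p ∈ affineMinorants φ ↔ ∀ t : ℝ, 0 ≤ t → ∀ r : ℝ, φ t ≤ r → p.1 * t - p.2 ≤ r :=
  ⟨fun h t ht _ hr => EReal.coe_le_coe_iff.1 ((h t ht).trans hr),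
    fun h t ht => le_of_forall_real_le (h t ht)⟩

theorem convex_affineMinorants (φ : ℝ → EReal) : Convex ℝ (affineMinorants φ) := by
  intro p hp q hq a b ha hb hab
  rw [mem_affineMinorants_iff] at *
  intro t ht r hr
  have h1 := mul_le_mul_of_nonneg_left (hp t ht r hr) ha
  have h2 := mul_le_mul_of_nonneg_left (hq t ht r hr) hb
  have : a * r + b * r = r := by rw [← add_mul, hab, one_mul]
  simp only [Prod.fst_add, Prod.smul_fst, Prod.snd_add, Prod.smul_snd, smul_eq_mul]
  linarith

namespace IsAdmissible

theorem convex_epigraph {φ : ℝ → EReal} (hφ : IsAdmissible φ) :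
    Convex ℝ {p : ℝ × ℝ | φ p.1 ≤ p.2} := by
  rintro ⟨x, y⟩ hx ⟨x', y'⟩ hx' a b ha hb hab
  have hb' : b = 1 - a := by linarith
  subst hb'
  simp only [Set.mem_ofPred_eq, Prod.smul_mk, Prod.mk_add_mk, smul_eq_mul] at *
  refine (hφ.convex x x' a ha (by linarith)).trans ?_
  push_cast
  refine add_le_add (mul_le_mul_of_nonneg_left hx (by exact_mod_cast ha)) ?_
  exact mul_le_mul_of_nonneg_left hx' (by exact_mod_cast hb)

theorem isClosed_epigraph {φ : ℝ → EReal} (hφ : IsAdmissible φ) :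
    IsClosed {p : ℝ × ℝ | φ p.1 ≤ p.2} := by
  have := hφ.lowerSemicontinuous.isClosed_epigraph
  exact this.preimage (f := fun p : ℝ × ℝ => ((p.1, (p.2 : EReal)) : ℝ × EReal))
    (continuous_fst.prodMk (continuous_coe_real_ereal.comp continuous_snd))

/-- Separation of a point below the graph from the epigraph. -/
theorem exists_separation {φ : ℝ → EReal} (hφ : IsAdmissible φ)
    {t₀ c : ℝ} (h : (c : EReal) < φ t₀) :
    ∃ α β u : ℝ, α * t₀ + β * c < u ∧ 0 ≤ β ∧ ∀ t r : ℝ, φ t ≤ r → u < α * t + β * r := by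
  obtain ⟨f, u, hu, hf⟩ := geometric_hahn_banach_point_closed hφ.convex_epigraph
    hφ.isClosed_epigraph (x := (t₀, c)) (by simpa using h)
  have hrep : ∀ t r : ℝ, f (t, r) = f (1, 0) * t + f (0, 1) * r := fun t r => by
    have : ((t, r) : ℝ × ℝ) = t • (1, 0) + r • (0, 1) := by simp
    rw [this, map_add, map_smul, map_smul, smul_eq_mul, smul_eq_mul]
    ring
  refine ⟨f (1, 0), f (0, 1), u, by rwa [← hrep], ?_, fun t r hr => ?_⟩
  -- The epigraph contains the vertical ray above `(1, 0)`, along which a negative `β` would make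
  -- the functional drop to `u`.
  · by_contra! hneg
    have key : ∀ s : ℝ, 0 ≤ s → u < f (1, 0) * 1 + f (0, 1) * s := fun s hs => by
      rw [← hrep]
      refine hf _ ?_
      simp only [Set.mem_ofPred_eq, hφ.map_one]
      exact_mod_cast hs
    have h0 := key 0 le_rfl
    have := key ((f (1, 0) - u) / -f (0, 1)) (div_nonneg (by linarith) (by linarith))
    have hne : f (0, 1) ≠ 0 := hneg.ne
    have h2 : f (0, 1) * ((f (1, 0) - u) / -f (0, 1)) = -(f (1, 0) - u) := by field_simp
    linarith
  · rw [← hrep]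
    exact hf _ hr

/-- The separated point `(1, -1)` lies strictly below `(1, 0)` on the graph, so the hyperplane
cannot be vertical and can be solved for the second coordinate. -/
theorem exists_affine_le {φ : ℝ → EReal} (hφ : IsAdmissible φ) :
    ∃ a b : ℝ, ∀ t r : ℝ, φ t ≤ r → a * t - b ≤ r := by
  obtain ⟨α, β, u, hu, hβ, H⟩ := hφ.exists_separation (t₀ := 1) (c := -1)
    (by rw [hφ.map_one]; exact_mod_cast (by norm_num : (-1 : ℝ) < 0))
  have h1 := H 1 0 (by rw [hφ.map_one]; rfl)
  have hβ' : 0 < β := by nlinarith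
  refine ⟨-α / β, -u / β, fun t r hr => ?_⟩
  have := H t r hr
  rw [show -α / β * t - -u / β = (u - α * t) / β by ring, div_le_iff₀ hβ']
  linarith

theorem affineMinorants_nonempty {φ : ℝ → EReal} (hφ : IsAdmissible φ) :
    (affineMinorants φ).Nonempty := by
  obtain ⟨a, b, h⟩ := hφ.exists_affine_le
  exact ⟨(a, b), mem_affineMinorants_iff.2 fun t _ => h t⟩

/-- `φ` is the supremum of its affine minorants. -/
theorem exists_affineMinorant_gt {φ : ℝ → EReal} (hφ : IsAdmissible φ)
    {t₀ c : ℝ} (h : (c : EReal) < φ t₀) :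
    ∃ p ∈ affineMinorants φ, c < p.1 * t₀ - p.2 := by
  obtain ⟨α, β, u, hu, hβ, H⟩ := hφ.exists_separation h
  rcases hβ.eq_or_lt with rfl | hβ
  -- Vertical hyperplane: `u - α t` is negative where `φ` is finite and positive at `t₀`. Adding a
  -- large multiple of it to a fixed affine minorant keeps a minorant and makes the value at `t₀` as
  -- large as desired.
  · obtain ⟨a, b, hab⟩ := hφ.exists_affine_le
    simp only [zero_mul, add_zero] at hu H
    obtain ⟨k, hk0, hk⟩ : ∃ k : ℝ, 0 ≤ k ∧ c < a * t₀ - b + k * (u - α * t₀) := by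
      refine ⟨(|c - (a * t₀ - b)| + 1) / (u - α * t₀), ?_, ?_⟩
      · have : 0 < u - α * t₀ := by linarith
        positivity
      · rw [div_mul_cancel₀ _ (by linarith : u - α * t₀ ≠ 0)]
        linarith [le_abs_self (c - (a * t₀ - b))]
    refine ⟨(a - k * α, b - k * u), mem_affineMinorants_iff.2 fun t _ r hr => ?_, ?_⟩
    · have := mul_le_mul_of_nonneg_left (H t r hr).le hk0
      linarith [hab t r hr]
    · simp only
      linarith
  · refine ⟨(-α / β, -u / β), mem_affineMinorants_iff.2 fun t _ r hr => ?_, ?_⟩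
    · have := H t r hr
      rw [show -α / β * t - -u / β = (u - α * t) / β by ring, div_le_iff₀ hβ]
      linarith
    · rw [show -α / β * t₀ - -u / β = (u - α * t₀) / β by ring, lt_div_iff₀ hβ]
      linarith

/-- The recession slope of `φ` is the supremum of the slopes of its affine minorants. -/
theorem exists_affineMinorant_slope_ge {φ : ℝ → EReal} (hφ : IsAdmissible φ)
    {c : ℝ} (h : (c : EReal) < slopeAtTop φ) :
    ∃ p ∈ affineMinorants φ, c ≤ p.1 := by
  obtain ⟨T, hT⟩ := eventually_atTop.1 ((eventually_lt_of_lt_liminf h).and (eventually_gt_atTop 0))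
  have hT0 : 0 < T := (hT T le_rfl).2
  obtain ⟨a, b, hab⟩ := hφ.exists_affine_le
  -- Beyond `T` the line of slope `c` through the origin is already below `φ`. On `[0, T]` the
  -- intercept is large enough to push the line below the minorant `a t - b`.
  refine ⟨(c, |b| + (|a| + |c|) * T), mem_affineMinorants_iff.2 fun t ht r hr => ?_, le_rfl⟩
  simp only
  rcases le_total T t with htT | htT
  · obtain ⟨h1, h2⟩ := hT t htT
    rw [EReal.lt_div_iff (by exact_mod_cast h2) (EReal.coe_ne_top t)] at h1
    have : c * t < r := by exact_mod_cast h1.trans_le hr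
    have : 0 ≤ |b| + (|a| + |c|) * T := by positivity
    linarith
  · have h1 := hab t r hr
    have h2 : c * t ≤ |c| * T := by
      have := le_abs_self (c * t)
      rw [abs_mul, abs_of_nonneg ht] at this
      nlinarith [abs_nonneg c]
    have h3 : -(|a| * T) ≤ a * t := by
      have := neg_abs_le (a * t)
      rw [abs_mul, abs_of_nonneg ht] at this
      nlinarith [abs_nonneg a]
    linarith [le_abs_self b]

end IsAdmissible

theorem le_slopeAtTop {φ : ℝ → EReal} {p : ℝ × ℝ} (hp : p ∈ affineMinorants φ) :
    (p.1 : EReal) ≤ slopeAtTop φ := by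
  have ht : Tendsto (fun x : ℝ => (((p.1 - p.2 / x : ℝ)) : EReal)) atTop (nhds (p.1 : EReal)) := by
    refine (continuous_coe_real_ereal.tendsto _).comp ?_
    have := (tendsto_const_nhds (x := p.1)).sub
      ((tendsto_const_nhds (x := p.2)).div_atTop tendsto_id)
    simpa using this
  rw [← ht.liminf_eq]
  refine liminf_le_liminf ?_
  filter_upwards [eventually_gt_atTop 0] with x hx
  rw [EReal.le_div_iff_mul_le (by exact_mod_cast hx) (EReal.coe_ne_top x)]
  refine le_trans (le_of_eq ?_) (hp x hx.le)
  rw [← EReal.coe_mul]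
  congr 1
  field_simp

/-! ### Integrals of extended real-valued functions. -/

theorem coe_integral_eq_sub {X : Type*} [MeasurableSpace X] {m : Measure X} {r : X → ℝ}
    (hr : Integrable r m) :
    ((∫ x, r x ∂m : ℝ) : EReal)
      = ((∫⁻ x, ENNReal.ofReal (r x) ∂m : ℝ≥0∞) : EReal)
        - ((∫⁻ x, ENNReal.ofReal (-r x) ∂m : ℝ≥0∞) : EReal) := by
  have h1 : ∫⁻ x, ENNReal.ofReal (r x) ∂m ≠ ⊤ := hr.lintegral_lt_top.ne
  have h2 : ∫⁻ x, ENNReal.ofReal (-r x) ∂m ≠ ⊤ := hr.neg.lintegral_lt_top.ne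
  rw [integral_eq_lintegral_pos_part_sub_lintegral_neg_part hr, EReal.coe_sub,
    EReal.coe_ennreal_toReal h1, EReal.coe_ennreal_toReal h2]

theorem coe_integral_le_eintegral {X : Type*} [MeasurableSpace X] {m : Measure X} {r : X → ℝ}
    {G : X → EReal} (hr : Integrable r m) (h : ∀ᵐ x ∂m, (r x : EReal) ≤ G x) :
    ((∫ x, r x ∂m : ℝ) : EReal) ≤ eintegral m G := by
  rw [coe_integral_eq_sub hr, eintegral]
  refine EReal.sub_le_sub ?_ ?_
  · refine EReal.coe_ennreal_le_coe_ennreal_iff.2 (lintegral_mono_ae ?_)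
    filter_upwards [h] with x hx
    simpa using EReal.toENNReal_le_toENNReal hx
  · refine EReal.coe_ennreal_le_coe_ennreal_iff.2 (lintegral_mono_ae ?_)
    filter_upwards [h] with x hx
    have := EReal.toENNReal_le_toENNReal (EReal.neg_le_neg_iff.2 hx)
    rwa [← EReal.coe_neg, EReal.toENNReal_of_ne_top (EReal.coe_ne_top _), EReal.toReal_coe] at this

/-- This is `G = (G - r) + r` split into positive and negative parts, with the negative parts moved
across so that no subtraction occurs and both sides can be integrated in `ℝ≥0∞`. -/
theorem toENNReal_add_ofReal_neg {G : EReal} {r : ℝ} (h : (r : EReal) ≤ G) :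
    G.toENNReal + ENNReal.ofReal (-r)
      = (G - r).toENNReal + (ENNReal.ofReal r + (-G).toENNReal) := by
  induction G with
  | bot => simp at h
  | top => simp
  | coe g =>
    have h' : r ≤ g := by exact_mod_cast h
    rw [← EReal.coe_sub, ← EReal.coe_neg]
    simp only [EReal.toENNReal_of_ne_top (EReal.coe_ne_top _), EReal.toReal_coe]
    rw [← ENNReal.toReal_eq_toReal_iff' (by finiteness) (by finiteness),
      ENNReal.toReal_add (by finiteness) (by finiteness),
      ENNReal.toReal_add (by finiteness) (by finiteness),
      ENNReal.toReal_add (by finiteness) (by finiteness)]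
    simp only [ENNReal.toReal_ofReal']
    have e1 := max_zero_sub_max_neg_zero_eq_self g
    have e2 := max_zero_sub_max_neg_zero_eq_self r
    rw [max_eq_left (sub_nonneg.2 h')]
    linarith

theorem coe_sub_eq_of_add_eq {A B E P Q : ℝ≥0∞} (hB : B ≠ ⊤) (hP : P ≠ ⊤) (hQ : Q ≠ ⊤)
    (h : A + Q = E + (P + B)) : (A : EReal) - B = E + ((P : EReal) - Q) := by
  lift B to NNReal using hB
  lift P to NNReal using hP
  lift Q to NNReal using hQ
  by_cases hA : A = ⊤
  · subst hA
    have hE : E = ⊤ := by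
      by_contra hE
      lift E to NNReal using hE
      rw [top_add] at h
      exact ENNReal.coe_ne_top (r := E + (P + B)) (by push_cast; exact h.symm)
    subst hE
    have e1 : ((B : ℝ≥0∞) : EReal) = ((B : ℝ) : EReal) := rfl
    have e2 : ((P : ℝ≥0∞) : EReal) = ((P : ℝ) : EReal) := rfl
    have e3 : ((Q : ℝ≥0∞) : EReal) = ((Q : ℝ) : EReal) := rfl
    rw [e1, e2, e3, ← EReal.coe_sub, EReal.coe_ennreal_top, EReal.top_sub_coe,
      EReal.top_add_coe]
  · have hE : E ≠ ⊤ := by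
      rintro rfl
      rw [top_add] at h
      lift A to NNReal using hA
      exact ENNReal.coe_ne_top (r := A + Q) (by push_cast; exact h)
    lift A to NNReal using hA
    lift E to NNReal using hE
    have h' : (A : ℝ) + Q = E + (P + B) := by exact_mod_cast h
    have e : ∀ z : NNReal, ((z : ℝ≥0∞) : EReal) = ((z : ℝ) : EReal) := fun _ => rfl
    simp only [e]
    norm_cast
    linarith

/-- Splitting off an integrable minorant leaves a nonnegative integrand, to which monotone
convergence applies. -/
theorem eintegral_eq_lintegral_sub_add {X : Type*} [MeasurableSpace X] {m : Measure X} {r : X → ℝ}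
    {G : X → EReal} (hG : Measurable G) (hrm : Measurable r) (hr : Integrable r m)
    (h : ∀ x, (r x : EReal) ≤ G x) :
    eintegral m G = ((∫⁻ x, (G x - r x).toENNReal ∂m : ℝ≥0∞) : EReal)
      + ((∫ x, r x ∂m : ℝ) : EReal) := by
  have h1 : ∫⁻ x, ENNReal.ofReal (r x) ∂m ≠ ⊤ := hr.lintegral_lt_top.ne
  have h2 : ∫⁻ x, ENNReal.ofReal (-r x) ∂m ≠ ⊤ := hr.neg.lintegral_lt_top.ne
  have h3 : ∫⁻ x, (-G x).toENNReal ∂m ≠ ⊤ := by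
    refine ne_top_of_le_ne_top h2 (lintegral_mono fun x => ?_)
    have := EReal.toENNReal_le_toENNReal (EReal.neg_le_neg_iff.2 (h x))
    rwa [← EReal.coe_neg, EReal.toENNReal_of_ne_top (EReal.coe_ne_top _), EReal.toReal_coe] at this
  rw [coe_integral_eq_sub hr, eintegral]
  refine coe_sub_eq_of_add_eq h3 h1 h2 ?_
  rw [← lintegral_add_left (by fun_prop), ← lintegral_add_left (by fun_prop),
    ← lintegral_add_right _ (by fun_prop)]
  exact lintegral_congr fun x => toENNReal_add_ofReal_neg (h x)

/-! ### Dual pairs and continuous approximation of finite maxima. -/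

/-- The pairs of continuous functions whose values are affine minorants of `φ` on `[0, ∞)`. -/
def dualPairs (X : Type*) [TopologicalSpace X] (φ : ℝ → EReal) : Set (C(X, ℝ) × C(X, ℝ)) :=
  {p | ∀ x, (p.1 x, p.2 x) ∈ affineMinorants φ}

theorem convex_dualPairs (X : Type*) [TopologicalSpace X] (φ : ℝ → EReal) :
    Convex ℝ (dualPairs X φ) := fun _ hp _ hq _ _ ha hb hab x =>
  convex_affineMinorants φ (hp x) (hq x) ha hb hab

section Approximation

variable {X : Type*} [MetricSpace X] [CompactSpace X] [MeasurableSpace X] [BorelSpace X]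

theorem _root_.ContinuousMap.integrable_of_compactSpace (f : C(X, ℝ)) (m : Measure X)
    [IsFiniteMeasure m] : Integrable f m := by
  rw [← integrableOn_univ]
  exact f.continuous.continuousOn.integrableOn_compact isCompact_univ

theorem _root_.ContinuousMap.integrable_mul (f : C(X, ℝ)) {m : Measure X} {k : X → ℝ}
    (hk : Integrable k m) : Integrable (fun x => f x * k x) m := by
  obtain ⟨C, hC⟩ := isCompact_univ.exists_bound_of_continuousOn f.continuous.continuousOn
  exact hk.bdd_mul f.continuous.aestronglyMeasurable
    (Eventually.of_forall fun x => hC x (Set.mem_univ x))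

/-- The exact mixing weight is the indicator of `{g' ≤ g}`. Regularity traps this set between a
closed `K` and an open `U`, and a Urysohn function is exact off `U \ K` and costs at most `|g - g'|`
on it. -/
theorem exists_continuousMap_mix_close_max {m : Measure X} [IsFiniteMeasure m] {g g' : X → ℝ}
    (hg : Measurable g) (hg' : Measurable g') (hgi : Integrable g m) (hgi' : Integrable g' m)
    {ε : ℝ≥0∞} (hε : ε ≠ 0) :
    ∃ u : C(X, ℝ), (∀ x, u x ∈ Set.Icc (0 : ℝ) 1) ∧
      ∫⁻ x, ‖max (g x) (g' x) - (u x * g x + (1 - u x) * g' x)‖ₑ ∂m ≤ ε := by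
  -- Regularity is used for the measure weighted by `|g - g'|`, since the error is measured in mean.
  let m' := m.withDensity fun x => ‖g x - g' x‖ₑ
  have : IsFiniteMeasure m' := isFiniteMeasure_withDensity (hgi.sub hgi').2.ne
  have hA : MeasurableSet {x | g' x ≤ g x} := measurableSet_le hg' hg
  have hε2 : ε / 2 ≠ 0 := by simpa using hε
  obtain ⟨K, hKA, hK, hKm⟩ := hA.exists_isClosed_sdiff_lt (μ := m') (by finiteness) hε2
  obtain ⟨U, hAU, hU, -, hUm⟩ := hA.exists_isOpen_sdiff_lt (μ := m') (by finiteness) hε2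
  obtain ⟨u, hu0, hu1, hu⟩ := exists_continuous_zero_one_of_isClosed hU.isClosed_compl hK
    (Set.disjoint_left.2 fun x hx hxK => hx (hAU (hKA hxK)))
  refine ⟨u, hu, ?_⟩
  have hUK : MeasurableSet (U \ K) := hU.measurableSet.diff hK.measurableSet
  calc ∫⁻ x, ‖max (g x) (g' x) - (u x * g x + (1 - u x) * g' x)‖ₑ ∂m
      ≤ ∫⁻ x, (U \ K).indicator (fun x => ‖g x - g' x‖ₑ) x ∂m := by
        refine lintegral_mono fun x => ?_
        by_cases hx : x ∈ U \ K
        · rw [Set.indicator_of_mem hx]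
          rw [enorm_le_iff_norm_le, Real.norm_eq_abs, Real.norm_eq_abs]
          obtain ⟨h0, h1⟩ := hu x
          rcases le_total (g x) (g' x) with h | h
          · rw [max_eq_right h, show g' x - (u x * g x + (1 - u x) * g' x)
              = -(u x * (g x - g' x)) by ring, abs_neg, abs_mul, abs_of_nonneg h0]
            exact mul_le_of_le_one_left (abs_nonneg _) h1
          · rw [max_eq_left h, show g x - (u x * g x + (1 - u x) * g' x)
              = (1 - u x) * (g x - g' x) by ring, abs_mul, abs_of_nonneg (sub_nonneg.2 h1)]
            exact mul_le_of_le_one_left (abs_nonneg _) (by linarith)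
        · rw [Set.indicator_of_notMem hx]
          simp only [Set.mem_sdiff, not_and_not_right] at hx
          by_cases hxU : x ∈ U
          · have hxK := hx hxU
            have h1 : u x = 1 := hu1 hxK
            have h2 : g' x ≤ g x := hKA hxK
            simp [h1, max_eq_left h2]
          · have h1 : u x = 0 := hu0 hxU
            have h2 : g x ≤ g' x := by
              by_contra! h
              exact hxU (hAU h.le)
            simp [h1, max_eq_right h2]
    _ = m' (U \ K) := by
        rw [lintegral_indicator hUK, withDensity_apply _ hUK]
    _ ≤ m' ((U \ {x | g' x ≤ g x}) ∪ ({x | g' x ≤ g x} \ K)) :=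
        measure_mono (by
          rintro x ⟨h1, h2⟩
          by_cases h : x ∈ {x | g' x ≤ g x}
          · exact Or.inr ⟨h, h2⟩
          · exact Or.inl ⟨h1, h⟩)
    _ ≤ ε / 2 + ε / 2 := (measure_union_le _ _).trans (add_le_add hUm.le hKm.le)
    _ = ε := ENNReal.add_halves ε

/-- Finite maxima of the functions `a p - b q`, `(a, b)` an affine minorant, are limits in mean of
functions `h p - ψ q` with `(h, ψ)` a dual pair. -/
theorem exists_dualPairs_close_partialSups {φ : ℝ → EReal} {m : Measure X} [IsFiniteMeasure m]
    {p q : X → ℝ} (hp : Measurable p) (hq : Measurable q) (hpi : Integrable p m)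
    (hqi : Integrable q m) {s : ℕ → ℝ × ℝ} (hs : ∀ n, s n ∈ affineMinorants φ) (n : ℕ)
    {ε : ℝ≥0∞} (hε : ε ≠ 0) :
    ∃ d ∈ dualPairs X φ,
      ∫⁻ x, ‖partialSups (fun i x => (s i).1 * p x - (s i).2 * q x) n x
        - (d.1 x * p x - d.2 x * q x)‖ₑ ∂m ≤ ε := by
  induction n generalizing ε with
  | zero =>
    refine ⟨(ContinuousMap.const X (s 0).1, ContinuousMap.const X (s 0).2), fun x => hs 0, ?_⟩
    simp
  | succ n ih =>
    have hε2 : ε / 2 ≠ 0 := by simpa using hε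
    obtain ⟨d, hd, hdm⟩ := ih hε2
    obtain ⟨u, hu, hum⟩ := exists_continuousMap_mix_close_max (m := m)
      (g := fun x => d.1 x * p x - d.2 x * q x)
      (g' := fun x => (s (n + 1)).1 * p x - (s (n + 1)).2 * q x)
      ((d.1.continuous.measurable.mul hp).sub (d.2.continuous.measurable.mul hq))
      (by fun_prop) ((d.1.integrable_mul hpi).sub (d.2.integrable_mul hqi))
      ((hpi.const_mul _).sub (hqi.const_mul _)) hε2
    refine ⟨(u * d.1 + (1 - u) * ContinuousMap.const X (s (n + 1)).1,
      u * d.2 + (1 - u) * ContinuousMap.const X (s (n + 1)).2), fun x => ?_, ?_⟩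
    · have := convex_affineMinorants φ (hd x) (hs (n + 1)) (hu x).1 (sub_nonneg.2 (hu x).2)
        (by ring)
      exact this
    · refine (lintegral_mono fun x => ?_).trans ((lintegral_add_right _ ?_).le.trans
        ((add_le_add hdm hum).trans (ENNReal.add_halves ε).le))
      -- The intermediate point is the maximum of the approximating function and the new affine
      -- term: replacing one entry of a maximum costs at most the change in that entry.
      · rw [partialSups_add_one, Pi.sup_apply, ← edist_eq_enorm_sub]
        refine (edist_triangle _
          (max (d.1 x * p x - d.2 x * q x) ((s (n + 1)).1 * p x - (s (n + 1)).2 * q x)) _).trans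
          (add_le_add ?_ (le_of_eq ?_))
        · rw [edist_eq_enorm_sub, enorm_le_iff_norm_le, Real.norm_eq_abs, Real.norm_eq_abs]
          exact abs_max_sub_max_le_abs _ _ _
        · rw [edist_eq_enorm_sub]
          congr 1
          simp
          ring
      · have h1 := d.1.continuous.measurable
        have h2 := d.2.continuous.measurable
        have h3 := u.continuous.measurable
        fun_prop

end Approximation

theorem coe_lt_of_lt_toENNReal {c : ℝ≥0∞} {y : EReal} (h : c < y.toENNReal) : (c : EReal) < y := by
  by_contra! hy
  have := EReal.toENNReal_le_toENNReal hy
  rw [EReal.toENNReal_coe] at this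
  exact absurd h (not_lt.2 this)

/-! ### Variational formula for the divergence. -/

section Duality

variable {X : Type*} [MetricSpace X] [CompactSpace X] [MeasurableSpace X] [BorelSpace X]

theorem integrable_toReal_rnDeriv_mul (ξ ν : Measure X) [IsFiniteMeasure ξ] (h : C(X, ℝ)) :
    Integrable (fun x => h x * (ξ.rnDeriv ν x).toReal) ν :=
  h.integrable_mul Measure.integrable_toReal_rnDeriv

theorem integral_eq_integral_rnDeriv_add_singularPart (ξ ν : Measure X) [IsFiniteMeasure ξ]
    [IsFiniteMeasure ν] (h : C(X, ℝ)) :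
    ∫ x, h x ∂ξ = ∫ x, h x * (ξ.rnDeriv ν x).toReal ∂ν + ∫ x, h x ∂(ξ.singularPart ν) := by
  conv_lhs => rw [← ξ.rnDeriv_add_singularPart ν]
  have hfin : IsFiniteMeasure (ν.withDensity (ξ.rnDeriv ν)) :=
    isFiniteMeasure_of_le ξ (Measure.withDensity_rnDeriv_le ξ ν)
  rw [integral_add_measure (h.integrable_of_compactSpace _) (h.integrable_of_compactSpace _),
    integral_withDensity_eq_integral_toReal_smul (Measure.measurable_rnDeriv ξ ν)
      (Measure.rnDeriv_lt_top ξ ν)]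
  simp only [smul_eq_mul, mul_comm]

/-- On the absolutely continuous part the minorant inequality is integrated at the density. On the
singular part `d.1` is bounded by its maximum, which is the slope of a minorant and hence at most
`slopeAtTop φ`. -/
theorem coe_integral_sub_integral_le_fDiv {φ : ℝ → EReal} (ξ ν : Measure X)
    [IsFiniteMeasure ξ] [IsFiniteMeasure ν] [Nonempty X] {d : C(X, ℝ) × C(X, ℝ)}
    (hd : d ∈ dualPairs X φ) :
    ((∫ x, d.1 x ∂ξ - ∫ x, d.2 x ∂ν : ℝ) : EReal) ≤ fDiv φ ξ ν := by
  have hi := integrable_toReal_rnDeriv_mul ξ ν d.1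
  have hi2 := d.2.integrable_of_compactSpace ν
  rw [integral_eq_integral_rnDeriv_add_singularPart ξ ν d.1, add_sub_right_comm,
    ← integral_sub hi hi2, EReal.coe_add, fDiv]
  refine add_le_add (coe_integral_le_eintegral (hi.sub hi2)
    (Eventually.of_forall fun x => hd x _ ENNReal.toReal_nonneg)) ?_
  obtain ⟨x, -, hx⟩ := isCompact_univ.exists_isMaxOn Set.univ_nonempty
    d.1.continuous.continuousOn
  calc ((∫ y, d.1 y ∂(ξ.singularPart ν) : ℝ) : EReal)
      ≤ ((∫ _, d.1 x ∂(ξ.singularPart ν) : ℝ) : EReal) :=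
        EReal.coe_le_coe_iff.2 (integral_mono (d.1.integrable_of_compactSpace _)
          (integrable_const _) fun y => hx (Set.mem_univ y))
    _ = (d.1 x : EReal) * ((ξ.singularPart ν Set.univ : ℝ≥0∞) : EReal) := by
        rw [integral_const, smul_eq_mul, mul_comm, EReal.coe_mul, measureReal_def,
          EReal.coe_ennreal_toReal (measure_ne_top _ _)]
    _ ≤ _ := mul_le_mul_of_nonneg_right (le_slopeAtTop (hd x)) (EReal.coe_ennreal_nonneg _)

/-- Over countably many dense affine minorants `(a, b)`, the supremum of `a p - b q` dominates `φ`
of the density where `ν` lives and the recession slope where the singular part lives. Monotone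
convergence selects a finite maximum with integral above `c`, and continuous mixing approximates it
by a dual pair. -/
theorem IsAdmissible.exists_dualPairs_gt {φ : ℝ → EReal} (hφ : IsAdmissible φ) (ξ ν : Measure X)
    [IsFiniteMeasure ξ] [IsFiniteMeasure ν] {c : ℝ} (hc : (c : EReal) < fDiv φ ξ ν) :
    ∃ d ∈ dualPairs X φ, c < ∫ x, d.1 x ∂ξ - ∫ x, d.2 x ∂ν := by
  classical
  have : Nonempty (affineMinorants φ) := hφ.affineMinorants_nonempty.to_subtype
  let s : ℕ → ℝ × ℝ := fun n => (TopologicalSpace.denseSeq (affineMinorants φ) n : ℝ × ℝ)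
  have hs : ∀ n, s n ∈ affineMinorants φ := fun n => Subtype.coe_prop _
  have hdense : ∀ {l : ℝ × ℝ → ℝ}, Continuous l → ∀ {c : ℝ}, (∃ p ∈ affineMinorants φ, c < l p) →
      ∃ n, c < l (s n) := by
    rintro l hl c ⟨p, hp, hcp⟩
    obtain ⟨n, hn⟩ := (TopologicalSpace.denseRange_denseSeq (affineMinorants φ)).exists_mem_open
      (isOpen_lt continuous_const (hl.comp continuous_subtype_val)) ⟨⟨p, hp⟩, hcp⟩
    exact ⟨n, hn⟩
  obtain ⟨N, hN, hσN, hνN⟩ := Measure.mutuallySingular_singularPart ξ ν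
  set σ := ξ.singularPart ν with hσ
  let ρ : X → ℝ := fun x => (ξ.rnDeriv ν x).toReal
  have hρ : Measurable ρ := (Measure.measurable_rnDeriv ξ ν).ennreal_toReal
  have hρ0 : ∀ x, 0 ≤ ρ x := fun x => ENNReal.toReal_nonneg
  have hρi : Integrable ρ ν := Measure.integrable_toReal_rnDeriv
  have hν : ∀ᵐ x ∂ν, x ∈ N := by simpa [ae_iff] using! hνN
  have hσ' : ∀ᵐ x ∂σ, x ∉ N := by simpa [ae_iff] using hσN
  let m := ν + σ
  -- With `(p, q) = (ρ, 1)` on `N` and `(1, 0)` off it, the two terms of the divergence become one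
  -- integral against `m = ν + σ`.
  let p : X → ℝ := N.piecewise ρ 1
  let q : X → ℝ := N.piecewise 1 0
  have hp : Measurable p := hρ.piecewise hN measurable_const
  have hq : Measurable q := measurable_const.piecewise hN measurable_const
  have hpν : p =ᵐ[ν] ρ := hν.mono fun x hx => by simp [p, hx]
  have hpσ : p =ᵐ[σ] fun _ => 1 := hσ'.mono fun x hx => by simp [p, hx]
  have hqν : q =ᵐ[ν] fun _ => 1 := hν.mono fun x hx => by simp [q, hx]
  have hqσ : q =ᵐ[σ] fun _ => 0 := hσ'.mono fun x hx => by simp [q, hx]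
  have hpi : Integrable p m := integrable_add_measure.2
    ⟨hρi.congr hpν.symm, (integrable_const 1).congr hpσ.symm⟩
  have hqi : Integrable q m := integrable_add_measure.2
    ⟨(integrable_const 1).congr hqν.symm, (integrable_const 0).congr hqσ.symm⟩
  have hval : ∀ d : C(X, ℝ) × C(X, ℝ),
      ∫ x, (d.1 x * p x - d.2 x * q x) ∂m = ∫ x, d.1 x ∂ξ - ∫ x, d.2 x ∂ν := fun d => by
    have hdi : Integrable (fun x => d.1 x * p x - d.2 x * q x) m :=
      (d.1.integrable_mul hpi).sub (d.2.integrable_mul hqi)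
    have h1 : ∫ x, (d.1 x * p x - d.2 x * q x) ∂ν = ∫ x, (d.1 x * ρ x - d.2 x) ∂ν := by
      refine integral_congr_ae ?_
      filter_upwards [hpν, hqν] with x h1 h2
      rw [h1, h2, mul_one]
    have h2 : ∫ x, (d.1 x * p x - d.2 x * q x) ∂σ = ∫ x, d.1 x ∂σ := by
      refine integral_congr_ae ?_
      filter_upwards [hpσ, hqσ] with x h1 h2
      rw [h1, h2, mul_one, mul_zero, sub_zero]
    rw [integral_add_measure (integrable_add_measure.1 hdi).1 (integrable_add_measure.1 hdi).2,
      h1, h2, integral_sub (integrable_toReal_rnDeriv_mul ξ ν d.1)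
        (d.2.integrable_of_compactSpace ν),
      integral_eq_integral_rnDeriv_add_singularPart ξ ν d.1]
    ring
  let M : ℕ → X → ℝ := fun n => partialSups (fun i x => (s i).1 * p x - (s i).2 * q x) n
  have hMm : ∀ n, Measurable (M n) ∧ Integrable (M n) m := fun n => by
    induction n with
    | zero =>
      simp only [M, partialSups_zero]
      exact ⟨by fun_prop, (hpi.const_mul _).sub (hqi.const_mul _)⟩
    | succ n ih =>
      simp only [M, partialSups_add_one]
      exact ⟨ih.1.sup (by fun_prop), ih.2.sup ((hpi.const_mul _).sub (hqi.const_mul _))⟩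
  -- it suffices that some finite maximum has a large integral
  suffices H : ∃ n, c < ∫ x, M n x ∂m by
    obtain ⟨n, hn⟩ := H
    have hε : ENNReal.ofReal ((∫ x, M n x ∂m - c) / 2) ≠ 0 := by
      simp only [ne_eq, ENNReal.ofReal_eq_zero, not_le]
      linarith
    obtain ⟨d, hd, hdm⟩ := exists_dualPairs_close_partialSups (m := m) hp hq hpi hqi hs n hε
    refine ⟨d, hd, ?_⟩
    have hdi : Integrable (fun x => d.1 x * p x - d.2 x * q x) m :=
      (d.1.integrable_mul hpi).sub (d.2.integrable_mul hqi)
    rw [← hval d]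
    have h1 := norm_integral_le_lintegral_norm (μ := m)
      fun x => M n x - (d.1 x * p x - d.2 x * q x)
    rw [integral_sub (hMm n).2 hdi] at h1
    have h2 : (∫⁻ x, ENNReal.ofReal ‖M n x - (d.1 x * p x - d.2 x * q x)‖ ∂m).toReal
        ≤ (∫ x, M n x ∂m - c) / 2 := by
      refine ENNReal.toReal_le_of_le_ofReal (by linarith) ?_
      simpa only [ofReal_norm] using hdm
    have h3 := (le_abs_self _).trans (h1.trans h2)
    linarith
  have hr : ∀ x, M 0 x = (s 0).1 * p x - (s 0).2 * q x := fun x => by simp [M]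
  -- The excess of the integrand of the divergence over the first affine term `M 0`.
  let G : X → ℝ≥0∞ := N.piecewise (fun x => (φ (ρ x) - ((s 0).1 * ρ x - (s 0).2 : ℝ)).toENNReal)
    fun _ => (slopeAtTop φ - (s 0).1).toENNReal
  have hG : ∀ x, G x ≤ ⨆ n, ENNReal.ofReal (M n x - M 0 x) := fun x => by
    have key : ∀ {y : EReal} {a b : ℝ}, (∀ c : ℝ, (c : EReal) < y → ∃ p ∈ affineMinorants φ,
        c ≤ p.1 * a - p.2 * b) → p x = a → q x = b →
        (y - ((s 0).1 * a - (s 0).2 * b : ℝ)).toENNReal ≤ ⨆ n, ENNReal.ofReal (M n x - M 0 x) := by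
      rintro y a b hy rfl rfl
      refine le_of_forall_lt fun e he => ?_
      obtain ⟨e', he', he''⟩ := exists_between he
      have h1 := coe_lt_of_lt_toENNReal he''
      lift e' to NNReal using he''.ne_top
      have h2 : (((e' : ℝ) + ((s 0).1 * p x - (s 0).2 * q x) : ℝ) : EReal) < y := by
        rw [EReal.coe_add]
        exact EReal.lt_sub_iff_add_lt (Or.inl (EReal.coe_ne_bot _)) (Or.inl (EReal.coe_ne_top _))
          |>.1 h1
      obtain ⟨z, hz, hz2⟩ := EReal.lt_iff_exists_real_btwn.1 h2
      obtain ⟨p', hp', hp2⟩ := hy z hz2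
      obtain ⟨n, hn⟩ := hdense (l := fun w => w.1 * p x - w.2 * q x) (by fun_prop)
        ⟨p', hp', (EReal.coe_lt_coe_iff.1 hz).trans_le hp2⟩
      have h3 : (s n).1 * p x - (s n).2 * q x ≤ M n x :=
        le_partialSups (fun i x => (s i).1 * p x - (s i).2 * q x) n x
      refine he'.trans_le (le_iSup_of_le n ?_)
      rw [hr, ← ENNReal.ofReal_coe_nnreal]
      exact ENNReal.ofReal_le_ofReal (by linarith)
    by_cases hx : x ∈ N
    · have := key (y := φ (ρ x)) (a := ρ x) (b := 1) (fun c hc => by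
        obtain ⟨p, hp, hcp⟩ := hφ.exists_affineMinorant_gt hc
        exact ⟨p, hp, by linarith⟩) (by simp [p, hx]) (by simp [q, hx])
      simpa [G, hx] using this
    · have := key (y := slopeAtTop φ) (a := 1) (b := 0) (fun c hc => by
        obtain ⟨p, hp, hcp⟩ := hφ.exists_affineMinorant_slope_ge hc
        exact ⟨p, hp, by linarith⟩) (by simp [p, hx]) (by simp [q, hx])
      simpa [G, hx] using this
  have hmono : Monotone M := fun i j hij =>
    (partialSups (fun i x => (s i).1 * p x - (s i).2 * q x)).monotone hij
  have hGint : ∫⁻ x, G x ∂m ≤ ⨆ n, ENNReal.ofReal (∫ x, M n x ∂m - ∫ x, M 0 x ∂m) := by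
    refine (lintegral_mono hG).trans ?_
    rw [lintegral_iSup (f := fun n x => ENNReal.ofReal (M n x - M 0 x))
      (fun n => ((hMm n).1.sub (hMm 0).1).ennreal_ofReal)
      (fun i j hij x => ENNReal.ofReal_le_ofReal (sub_le_sub_right (hmono hij x) _))]
    refine iSup_mono fun n => ?_
    rw [← integral_sub (hMm n).2 (hMm 0).2]
    exact (ofReal_integral_eq_lintegral_ofReal ((hMm n).2.sub (hMm 0).2)
      (Eventually.of_forall fun x => sub_nonneg.2 (hmono (Nat.zero_le n) x))).ge
  have hfDiv : fDiv φ ξ ν ≤ ((∫⁻ x, G x ∂m : ℝ≥0∞) : EReal) + ((∫ x, M 0 x ∂m : ℝ) : EReal) := by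
    have hri : Integrable (fun x => (s 0).1 * ρ x - (s 0).2) ν :=
      (hρi.const_mul _).sub (integrable_const _)
    have e1 : ∫⁻ x, G x ∂ν = ∫⁻ x, (φ (ρ x) - ((s 0).1 * ρ x - (s 0).2 : ℝ)).toENNReal ∂ν :=
      lintegral_congr_ae (hν.mono fun x hx => by simp [G, hx])
    have e2 : ∫⁻ x, G x ∂σ = (slopeAtTop φ - (s 0).1).toENNReal * σ Set.univ := by
      rw [← lintegral_const]
      exact lintegral_congr_ae (hσ'.mono fun x hx => by simp [G, hx])
    have e3 : ∫ x, M 0 x ∂m = ∫ x, ((s 0).1 * ρ x - (s 0).2) ∂ν + (s 0).1 * (σ Set.univ).toReal := by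
      rw [integral_add_measure (integrable_add_measure.1 (hMm 0).2).1
        (integrable_add_measure.1 (hMm 0).2).2]
      congr 1
      · refine integral_congr_ae ?_
        filter_upwards [hpν, hqν] with x h1 h2
        rw [hr, h1, h2, mul_one]
      · have : ∫ x, M 0 x ∂σ = ∫ _, (s 0).1 ∂σ := by
          refine integral_congr_ae ?_
          filter_upwards [hpσ, hqσ] with x h1 h2
          rw [hr, h1, h2, mul_one, mul_zero, sub_zero]
        rw [this, integral_const, smul_eq_mul, mul_comm, measureReal_def]
    -- The slope may be `⊤`, so it is written as a nonnegative excess plus the real slope of `s 0`;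
    -- distributivity holds because the mass of `σ` is finite and nonnegative.
    have e4 : slopeAtTop φ * ((σ Set.univ : ℝ≥0∞) : EReal)
        = (((slopeAtTop φ - (s 0).1).toENNReal * σ Set.univ : ℝ≥0∞) : EReal)
          + (((s 0).1 * (σ Set.univ).toReal : ℝ) : EReal) := by
      have hle : 0 ≤ slopeAtTop φ - (s 0).1 :=
        EReal.sub_nonneg (Or.inr (EReal.coe_ne_top _)) (Or.inr (EReal.coe_ne_bot _)) |>.2
          (le_slopeAtTop (hs 0))
      rw [EReal.coe_ennreal_mul, EReal.coe_toENNReal hle, EReal.coe_mul,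
        EReal.coe_ennreal_toReal (measure_ne_top _ _)]
      obtain ⟨t, ht⟩ : ∃ t : ℝ, ((σ Set.univ : ℝ≥0∞) : EReal) = t :=
        ⟨_, (EReal.coe_ennreal_toReal (measure_ne_top σ _)).symm⟩
      have ht0 : (0 : EReal) ≤ t := ht ▸ EReal.coe_ennreal_nonneg _
      rw [ht, ← EReal.right_distrib_of_nonneg_of_ne_top ht0 (EReal.coe_ne_top t),
        EReal.sub_add_cancel]
    rw [fDiv, ← hσ, eintegral_eq_lintegral_sub_add (r := fun x => (s 0).1 * ρ x - (s 0).2)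
      (G := fun x => φ (ξ.rnDeriv ν x).toReal)
      (hφ.lowerSemicontinuous.measurable.comp hρ) (by fun_prop) hri
      (fun x => hs 0 _ (hρ0 x)), e4, e3, lintegral_add_measure, e1, e2]
    push_cast
    exact le_of_eq (by abel)
  have hlt := hc.trans_le hfDiv
  by_contra! hcon
  have hle : ∫⁻ x, G x ∂m ≤ ENNReal.ofReal (c - ∫ x, M 0 x ∂m) :=
    hGint.trans (iSup_le fun n => ENNReal.ofReal_le_ofReal (sub_le_sub_right (hcon n) _))
  have h1 : ((∫⁻ x, G x ∂m : ℝ≥0∞) : EReal) ≤ ((c - ∫ x, M 0 x ∂m : ℝ) : EReal) := by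
    refine (EReal.coe_ennreal_le_coe_ennreal_iff.2 hle).trans ?_
    rw [EReal.coe_ennreal_ofReal, max_eq_left (by linarith [hcon 0])]
  have h2 := hlt.trans_le (add_le_add_left h1 _)
  rw [← EReal.coe_add, EReal.coe_lt_coe_iff] at h2
  linarith

end Duality

/-! ### Conjugate penalties, the Lagrangian and almost optimal dual variables. -/

/-- `w ↦ lam * w ^ α` on `[0, ∞)` is the conjugate of the convex function `N` on `R`. -/
structure IsConjugatePenalty (lam α : ℝ) (R : Set ℝ) (N : ℝ → ℝ) : Prop where
  isClosed : IsClosed R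
  nonneg : ∀ r ∈ R, 0 ≤ r
  convexOn : ConvexOn ℝ R N
  continuousOn : ContinuousOn N R
  young : ∀ r ∈ R, ∀ w : ℝ, 0 ≤ w → r * w - N r ≤ lam * w ^ α
  exists_eq : ∀ w : ℝ, 0 ≤ w → ∃ r ∈ R, r * w - N r = lam * w ^ α

theorem _root_.ContinuousMap.integral_smul_add_smul {Z : Type*} [MetricSpace Z] [CompactSpace Z]
    [MeasurableSpace Z] [BorelSpace Z] (ρ : Measure Z) [IsFiniteMeasure ρ] (a b : ℝ)
    (f g : C(Z, ℝ)) : ∫ z, (a • f + b • g) z ∂ρ = a * ∫ z, f z ∂ρ + b * ∫ z, g z ∂ρ := by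
  rw [← integral_const_mul, ← integral_const_mul]
  exact integral_add ((f.integrable_of_compactSpace ρ).const_mul a)
    ((g.integrable_of_compactSpace ρ).const_mul b)

theorem exists_probabilityMeasure_mix {Z : Type*} [MetricSpace Z] [CompactSpace Z]
    [MeasurableSpace Z] [BorelSpace Z] (π π' : ProbabilityMeasure Z) {t : ℝ} (h0 : 0 ≤ t)
    (h1 : t ≤ 1) : ∃ π'' : ProbabilityMeasure Z, ∀ f : C(Z, ℝ),
      ∫ z, f z ∂(π'' : Measure Z)
        = t * ∫ z, f z ∂(π : Measure Z) + (1 - t) * ∫ z, f z ∂(π' : Measure Z) := by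
  refine ⟨⟨ENNReal.ofReal t • (π : Measure Z) + ENNReal.ofReal (1 - t) • (π' : Measure Z), ⟨?_⟩⟩,
    fun f => ?_⟩
  · simp [← ENNReal.ofReal_add h0 (sub_nonneg.2 h1)]
  · rw [ProbabilityMeasure.coe_mk, integral_add_measure
      ((f.integrable_of_compactSpace _).smul_measure ENNReal.ofReal_ne_top)
      ((f.integrable_of_compactSpace _).smul_measure ENNReal.ofReal_ne_top),
      integral_smul_measure, integral_smul_measure, ENNReal.toReal_ofReal h0,
      ENNReal.toReal_ofReal (sub_nonneg.2 h1), smul_eq_mul, smul_eq_mul]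

section

variable {X : Type*} [MetricSpace X] [MeasurableSpace X]

theorem exists_integral_ne_of_ne [BorelSpace X] {ξ ξ' : Measure X} [IsFiniteMeasure ξ]
    [IsFiniteMeasure ξ']
    (h : ξ ≠ ξ') : ∃ k : C(X, ℝ), ∫ x, k x ∂ξ ≠ ∫ x, k x ∂ξ' := by
  by_contra! hk
  exact h (ext_of_forall_integral_eq_of_IsFiniteMeasure fun f => hk f.toContinuousMap)

/-- The transport cost `∫ d dπ`. -/
def transportCost (π : Measure (X × X)) : ℝ := ∫ z, dist z.1 z.2 ∂π

theorem transportCost_nonneg (π : Measure (X × X)) : 0 ≤ transportCost π :=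
  integral_nonneg fun _ => dist_nonneg

variable [CompactSpace X] [BorelSpace X]

/-- The distance as a continuous function on the product. -/
def distMap (X : Type*) [MetricSpace X] : C(X × X, ℝ) := ⟨fun z => dist z.1 z.2, continuous_dist⟩

/-- The integrand on `X × X` of the Lagrangian. -/
def lagrangeIntegrand (v : (C(X, ℝ) × C(X, ℝ)) × (C(X, ℝ) × ℝ)) : C(X × X, ℝ) :=
  v.1.1.comp ContinuousMap.snd + v.2.2 • distMap X - v.2.1.comp ContinuousMap.fst

/-- The Lagrangian of the transport formulation of the Moreau-Yosida problem. -/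
def lagrangian (N : ℝ → ℝ) (μ ν : Measure X) (π : Measure (X × X))
    (v : (C(X, ℝ) × C(X, ℝ)) × (C(X, ℝ) × ℝ)) : ℝ :=
  ∫ z, lagrangeIntegrand v z ∂π + (∫ x, v.2.1 x ∂μ - ∫ x, v.1.2 x ∂ν - N v.2.2)

theorem integral_lagrangeIntegrand (π : Measure (X × X)) [IsFiniteMeasure π]
    (v : (C(X, ℝ) × C(X, ℝ)) × (C(X, ℝ) × ℝ)) :
    ∫ z, lagrangeIntegrand v z ∂π = ∫ x, v.1.1 x ∂(π.map Prod.snd) + v.2.2 * transportCost π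
      - ∫ x, v.2.1 x ∂(π.map Prod.fst) := by
  have h1 := (v.1.1.comp ContinuousMap.snd : C(X × X, ℝ)).integrable_of_compactSpace π
  have h2 := ((v.2.2 • distMap X : C(X × X, ℝ))).integrable_of_compactSpace π
  have h3 := (v.2.1.comp ContinuousMap.fst : C(X × X, ℝ)).integrable_of_compactSpace π
  rw [integral_map measurable_snd.aemeasurable v.1.1.continuous.aestronglyMeasurable,
    integral_map measurable_fst.aemeasurable v.2.1.continuous.aestronglyMeasurable,
    transportCost, ← integral_const_mul]
  exact (integral_sub (h1.add h2) h3).trans (congrArg₂ _ (integral_add h1 h2) rfl)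

theorem concaveOn_lagrangian {φ : ℝ → EReal} {R : Set ℝ} {N : ℝ → ℝ} (hN : ConvexOn ℝ R N)
    (μ ν : Measure X) [IsFiniteMeasure μ] [IsFiniteMeasure ν]
    (π : Measure (X × X)) [IsFiniteMeasure π] :
    ConcaveOn ℝ (dualPairs X φ ×ˢ {p : C(X, ℝ) × ℝ | p.2 ∈ R}) (lagrangian N μ ν π) := by
  refine ⟨(convex_dualPairs X φ).prod (hN.1.linear_preimage (LinearMap.snd ℝ C(X, ℝ) ℝ)),
    fun v hv w hw a b ha hb hab => ?_⟩
  have hint : lagrangeIntegrand (a • v + b • w)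
      = a • lagrangeIntegrand v + b • lagrangeIntegrand w := by
    ext z
    simp [lagrangeIntegrand, distMap]
    ring
  have hNle := hN.2 hv.2 hw.2 ha hb hab
  simp only [lagrangian, hint, Prod.fst_add, Prod.snd_add, Prod.smul_fst, Prod.smul_snd,
    ContinuousMap.integral_smul_add_smul,
    smul_eq_mul] at hNle ⊢
  linarith

/-- An almost optimal dual variable, from the minimax principle and an inf-convolution. -/
theorem IsAdmissible.exists_lipschitz_of_forall_lt {φ : ℝ → EReal} (hφ : IsAdmissible φ)
    {lam α : ℝ} {R : Set ℝ} {N : ℝ → ℝ} (hN : IsConjugatePenalty lam α R N) (x₀ : X)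
    (μ ν : ProbabilityMeasure X) {c : ℝ}
    (hc : ∀ π : ProbabilityMeasure (X × X), (π : Measure (X × X)).map Prod.fst = μ →
      (c : EReal) < fDiv φ ((π : Measure (X × X)).map Prod.snd) (ν : Measure X)
        + ((lam * transportCost (π : Measure (X × X)) ^ α : ℝ) : EReal)) :
    ∃ r ∈ R, ∃ f : X → ℝ, (∀ x y, f x - f y ≤ r * dist x y) ∧ f x₀ = 0 ∧
      ∀ ξ : ProbabilityMeasure X,
        ((c + (∫ x, f x ∂(ξ : Measure X) - ∫ x, f x ∂(μ : Measure X)) + N r : ℝ) : EReal)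
          ≤ fDiv φ (ξ : Measure X) (ν : Measure X) := by
  have : Nonempty X := ⟨x₀⟩
  have : Nonempty (ProbabilityMeasure (X × X)) :=
    ⟨⟨(μ : Measure X).prod (ν : Measure X), inferInstance⟩⟩
  obtain ⟨v, hv, hcv⟩ := exists_forall_le_of_forall_exists_lt
    (K := ProbabilityMeasure (X × X)) (S := dualPairs X φ ×ˢ {p : C(X, ℝ) × ℝ | p.2 ∈ R})
    (F := fun π v => lagrangian N (μ : Measure X) (ν : Measure X) (π : Measure (X × X)) v) (c := c)
    (fun v _ => (ProbabilityMeasure.continuous_integral_continuousMap _).add continuous_const)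
    (fun π π' t h0 h1 => by
      obtain ⟨π'', h⟩ := exists_probabilityMeasure_mix π π' h0 h1
      refine ⟨π'', fun v => ?_⟩
      simp only [lagrangian, h]
      ring)
    (fun π => concaveOn_lagrangian hN.convexOn _ _ _)
    (fun π => by
      by_cases hπ : (π : Measure (X × X)).map Prod.fst = μ
      -- If the first marginal is `μ`, take `k = 0`, an `r` attaining the penalty, and a dual pair
      -- almost attaining the divergence.
      · obtain ⟨r, hr, hrw⟩ := hN.exists_eq _ (transportCost_nonneg (π : Measure (X × X)))
        have : IsFiniteMeasure ((π : Measure (X × X)).map Prod.snd) := inferInstance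
        have h1 : ((c - lam * transportCost (π : Measure (X × X)) ^ α : ℝ) : EReal)
            < fDiv φ ((π : Measure (X × X)).map Prod.snd) (ν : Measure X) := by
          rw [EReal.coe_sub]
          exact (EReal.sub_lt_iff (Or.inl (EReal.coe_ne_bot _)) (Or.inl (EReal.coe_ne_top _))).2
            (hc π hπ)
        obtain ⟨d, hd, hcd⟩ := hφ.exists_dualPairs_gt _ _ h1
        refine ⟨(d, (0, r)), ⟨hd, hr⟩, ?_⟩
        simp only [lagrangian, integral_lagrangeIntegrand, ContinuousMap.zero_apply,
          integral_zero]
        linarith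
      · obtain ⟨k, hk⟩ := exists_integral_ne_of_ne hπ
        obtain ⟨p, hp⟩ := hφ.affineMinorants_nonempty
        obtain ⟨r, hr, -⟩ := hN.exists_eq 0 le_rfl
        let d : C(X, ℝ) × C(X, ℝ) := (ContinuousMap.const X p.1, ContinuousMap.const X p.2)
        let A := lagrangian N (μ : Measure X) (ν : Measure X) (π : Measure (X × X)) (d, (0, r))
        let δ := ∫ x, k x ∂(μ : Measure X) - ∫ x, k x ∂((π : Measure (X × X)).map Prod.fst)
        have hδ : δ ≠ 0 := sub_ne_zero.2 hk.symm
        -- If the marginal is wrong, `k` detects it, and the Lagrangian is affine in the multiple of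
        -- `k`; this multiple makes its value `c + 1`.
        refine ⟨(d, (((c + 1 - A) / δ) • k, r)), ⟨fun _ => hp, hr⟩, ?_⟩
        have : lagrangian N (μ : Measure X) (ν : Measure X) (π : Measure (X × X))
            (d, (((c + 1 - A) / δ) • k, r)) = A + (c + 1 - A) / δ * δ := by
          simp only [A, lagrangian, integral_lagrangeIntegrand, ContinuousMap.zero_apply,
            integral_zero, ContinuousMap.smul_apply, smul_eq_mul, integral_const_mul, δ]
          ring
        rw [this, div_mul_cancel₀ _ hδ]
        linarith)
  obtain ⟨⟨h, ψ⟩, ⟨k, r⟩⟩ := v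
  have hr0 := hN.nonneg r hv.2
  set C := ∫ x, k x ∂(μ : Measure X) - ∫ x, ψ x ∂(ν : Measure X) - N r with hC
  -- The Lagrangian bound at the Dirac mass of `(x, y)`.
  have hpt : ∀ x y, c - C + k x ≤ h y + r * dist x y := fun x y => by
    have := hcv ⟨Measure.dirac (x, y), inferInstance⟩
    simp only [lagrangian, ProbabilityMeasure.coe_mk, integral_dirac, lagrangeIntegrand,
      distMap] at this
    simp at this
    linarith
  have hbdd : ∀ x, BddBelow (Set.range fun y => h y + r * dist x y) := fun x =>
    ⟨c - C + k x, by rintro _ ⟨y, rfl⟩; exact hpt x y⟩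
  -- The inf-convolution lies between `c - C + k` and `h`, so it can replace `k` against `μ` and `h`
  -- against every `ξ`.
  let g : X → ℝ := fun x => ⨅ y, (h y + r * dist x y)
  have hglip : ∀ x y, g x - g y ≤ r * dist x y := fun x y => by
    have : g x - r * dist x y ≤ g y := le_ciInf fun z => by
      have h1 : g x ≤ h z + r * dist x z := ciInf_le (hbdd x) z
      have h2 := mul_le_mul_of_nonneg_left (dist_triangle x y z) hr0
      linarith
    linarith
  have hgh : ∀ x, g x ≤ h x := fun x => by
    have : g x ≤ h x + r * dist x x := ciInf_le (hbdd x) x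
    simpa using this
  have hgk : ∀ x, c - C + k x ≤ g x := fun x => le_ciInf (hpt x)
  have hgc : Continuous g := by
    refine (LipschitzWith.of_le_add_mul r.toNNReal fun x y => ?_).continuous
    rw [Real.coe_toNNReal r hr0]
    linarith [hglip x y]
  have hgi : ∀ ξ : ProbabilityMeasure X, Integrable g (ξ : Measure X) := fun ξ =>
    (⟨g, hgc⟩ : C(X, ℝ)).integrable_of_compactSpace _
  -- Subtracting a constant does not change the difference of integrals against two probability
  -- measures.
  refine ⟨r, hv.2, fun x => g x - g x₀, fun x y => by simpa using hglip x y, sub_self _,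
    fun ξ => ?_⟩
  refine le_trans (EReal.coe_le_coe_iff.2 ?_)
    (coe_integral_sub_integral_le_fDiv (ξ : Measure X) (ν : Measure X) hv.1)
  have e : ∀ ξ : ProbabilityMeasure X,
      ∫ x, (g x - g x₀) ∂(ξ : Measure X) = ∫ x, g x ∂(ξ : Measure X) - g x₀ := fun ξ => by
    rw [integral_sub (hgi ξ) (integrable_const _)]
    simp
  rw [e, e]
  have h1 : ∫ x, g x ∂(ξ : Measure X) ≤ ∫ x, h x ∂(ξ : Measure X) :=
    integral_mono (hgi ξ) (h.integrable_of_compactSpace _) hgh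
  have h2 : ∫ x, (c - C + k x) ∂(μ : Measure X) ≤ ∫ x, g x ∂(μ : Measure X) :=
    integral_mono ((integrable_const _).add (k.integrable_of_compactSpace _)) (hgi μ) hgk
  rw [integral_add (integrable_const _) (k.integrable_of_compactSpace _)] at h2
  simp at h2
  linarith

end

/-! ### Semicontinuity of the divergence and attainment in the dual problem. -/

theorem continuous_integral_boundedContinuousFunction_left {X : Type*} [MetricSpace X]
    [MeasurableSpace X] [BorelSpace X] (ξ : Measure X) [IsFiniteMeasure ξ] :
    Continuous fun f : BoundedContinuousFunction X ℝ => ∫ x, f x ∂ξ := by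
  refine continuous_iff_continuousAt.2 fun f => ?_
  refine continuousAt_of_dominated (bound := fun _ => ‖f‖ + 1)
    (Eventually.of_forall fun g => g.continuous.aestronglyMeasurable) ?_ (integrable_const _)
    (Eventually.of_forall fun x => (continuous_eval_const x).continuousAt)
  filter_upwards [continuous_norm.continuousAt.eventually (gt_mem_nhds (lt_add_one ‖f‖))] with g hg
  exact Eventually.of_forall fun x => (g.norm_coe_le_norm x).trans hg.le

theorem isClosed_setOf_map_eq {X Y : Type*} [MetricSpace X] [MeasurableSpace X]
    [BorelSpace X] [MetricSpace Y] [MeasurableSpace Y] [BorelSpace Y]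
    {g : X → Y} (hg : Continuous g) (ξ : ProbabilityMeasure Y) :
    IsClosed {π : ProbabilityMeasure X | (π : Measure X).map g = ξ} := by
  have : {π : ProbabilityMeasure X | (π : Measure X).map g = ξ}
      = {π | π.map hg.measurable.aemeasurable = ξ} := by
    ext π
    simp only [Set.mem_ofPred_eq, ← ProbabilityMeasure.toMeasure_injective.eq_iff,
      ProbabilityMeasure.toMeasure_map]
  rw [this]
  exact isClosed_eq (ProbabilityMeasure.continuous_map hg) continuous_const

theorem le_dual_of_forall_le {X : Type*} [MeasurableSpace X] {φ : ℝ → EReal}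
    {μ ν : ProbabilityMeasure X} {f : X → ℝ} {c n : ℝ}
    (h : ∀ ξ : ProbabilityMeasure X,
        ((c + (∫ x, f x ∂(ξ : Measure X) - ∫ x, f x ∂(μ : Measure X)) + n : ℝ) : EReal)
          ≤ fDiv φ (ξ : Measure X) (ν : Measure X)) :
    (c : EReal) ≤ ((∫ x, f x ∂(μ : Measure X) : ℝ) : EReal) - fDivConj φ f (ν : Measure X)
      - (n : EReal) := by
  have hconj : fDivConj φ f (ν : Measure X) ≤ ((∫ x, f x ∂(μ : Measure X) - n - c : ℝ) : EReal) :=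
    iSup_le fun ξ => by
      refine (EReal.sub_le_sub le_rfl (h ξ)).trans ?_
      rw [← EReal.coe_sub, EReal.coe_le_coe_iff]
      linarith
  refine le_trans ?_ (EReal.sub_le_sub (EReal.sub_le_sub le_rfl hconj) le_rfl)
  rw [← EReal.coe_sub, ← EReal.coe_sub, EReal.coe_le_coe_iff]
  linarith

section

variable {X : Type*} [MetricSpace X] [CompactSpace X] [MeasurableSpace X] [BorelSpace X]

theorem fDiv_self {φ : ℝ → EReal} (hφ : φ 1 = 0) (ν : Measure X) [IsFiniteMeasure ν] :
    fDiv φ ν ν = 0 := by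
  have h : ∀ᵐ x ∂ν, φ (ν.rnDeriv ν x).toReal = 0 := by
    filter_upwards [ν.rnDeriv_self] with x hx
    simp [hx, hφ]
  have h1 : ∫⁻ x, (φ (ν.rnDeriv ν x).toReal).toENNReal ∂ν = 0 := by
    rw [lintegral_congr_ae (g := fun _ => 0) (h.mono fun x hx => by simp [hx]), lintegral_zero]
  have h2 : ∫⁻ x, (-φ (ν.rnDeriv ν x).toReal).toENNReal ∂ν = 0 := by
    rw [lintegral_congr_ae (g := fun _ => 0) (h.mono fun x hx => by simp [hx]), lintegral_zero]
  simp [fDiv, eintegral, h1, h2, Measure.singularPart_self]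

theorem IsAdmissible.fDiv_ne_bot [Nonempty X] {φ : ℝ → EReal} (hφ : IsAdmissible φ)
    (ξ ν : Measure X) [IsFiniteMeasure ξ] [IsFiniteMeasure ν] : fDiv φ ξ ν ≠ ⊥ := by
  obtain ⟨p, hp⟩ := hφ.affineMinorants_nonempty
  have := coe_integral_sub_integral_le_fDiv ξ ν (φ := φ)
    (d := (ContinuousMap.const X p.1, ContinuousMap.const X p.2)) fun _ => hp
  exact ((EReal.bot_lt_coe _).trans_le this).ne'

/-- By the variational formula the divergence is a supremum of weakly continuous functionals of `ξ`.
-/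
theorem IsAdmissible.lowerSemicontinuous_fDiv [Nonempty X] {φ : ℝ → EReal} (hφ : IsAdmissible φ)
    (ν : Measure X) [IsFiniteMeasure ν] :
    LowerSemicontinuous fun ξ : ProbabilityMeasure X => fDiv φ (ξ : Measure X) ν := by
  intro ξ y hy
  obtain ⟨c, hyc, hc⟩ := EReal.lt_iff_exists_real_btwn.1 hy
  obtain ⟨d, hd, hcd⟩ := hφ.exists_dualPairs_gt _ _ hc
  have hcont : Continuous fun ξ : ProbabilityMeasure X =>
      ∫ x, d.1 x ∂(ξ : Measure X) - ∫ x, d.2 x ∂ν :=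
    (ProbabilityMeasure.continuous_integral_continuousMap d.1).sub continuous_const
  filter_upwards [hcont.continuousAt.eventually (lt_mem_nhds hcd)] with ξ' hξ'
  exact hyc.trans ((EReal.coe_lt_coe_iff.2 hξ').trans_le
    (coe_integral_sub_integral_le_fDiv _ _ hd))

/-- Existence of an optimal dual variable. -/
theorem IsAdmissible.exists_lipschitz_of_forall_le {φ : ℝ → EReal} (hφ : IsAdmissible φ)
    {lam α : ℝ} {R : Set ℝ} {N : ℝ → ℝ} (hN : IsConjugatePenalty lam α R N) (x₀ : X)
    (μ ν : ProbabilityMeasure X) {c : ℝ}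
    (hc : ∀ π : ProbabilityMeasure (X × X), (π : Measure (X × X)).map Prod.fst = μ →
      (c : EReal) ≤ fDiv φ ((π : Measure (X × X)).map Prod.snd) (ν : Measure X)
        + ((lam * transportCost (π : Measure (X × X)) ^ α : ℝ) : EReal)) :
    ∃ r ∈ R, ∃ f : X → ℝ, (∀ x y, f x - f y ≤ r * dist x y) ∧ f x₀ = 0 ∧
      ∀ ξ : ProbabilityMeasure X,
        ((c + (∫ x, f x ∂(ξ : Measure X) - ∫ x, f x ∂(μ : Measure X)) + N r : ℝ) : EReal)
          ≤ fDiv φ (ξ : Measure X) (ν : Measure X) := by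
  have : Nonempty X := ⟨x₀⟩
  let e : ℕ → ℝ := fun n => 1 / ((n : ℝ) + 1)
  have he0 : ∀ n, 0 < e n := fun n => Nat.one_div_pos_of_nat
  have he1 : ∀ n, e n ≤ 1 := fun n => by
    have : (0 : ℝ) ≤ n := Nat.cast_nonneg n
    exact div_le_one_of_le₀ (by linarith) (by linarith)
  have key := fun n => hφ.exists_lipschitz_of_forall_lt hN x₀ μ ν (c := c - e n) fun π hπ =>
    (EReal.coe_lt_coe_iff.2 (by linarith [he0 n])).trans_le (hc π hπ)
  choose r hr f hflip hf0 hf using key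
  obtain ⟨D, hD⟩ : ∃ D, ∀ x y : X, dist x y ≤ D :=
    ⟨_, fun x y => Metric.dist_le_diam_of_mem isCompact_univ.isBounded (Set.mem_univ x)
      (Set.mem_univ y)⟩
  have hD0 : 0 ≤ D := dist_nonneg.trans (hD x₀ x₀)
  have hr0 : ∀ n, 0 ≤ r n := fun n => hN.nonneg _ (hr n)
  have hcont : ∀ n, Continuous (f n) := fun n => by
    refine (LipschitzWith.of_le_add_mul (r n).toNNReal fun x y => ?_).continuous
    rw [Real.coe_toNNReal _ (hr0 n)]
    linarith [hflip n x y]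
  have hint : ∀ n (ξ : ProbabilityMeasure X), Integrable (f n) (ξ : Measure X) := fun n ξ =>
    (⟨f n, hcont n⟩ : C(X, ℝ)).integrable_of_compactSpace _
  -- the Lipschitz constants are bounded, by the conjugacy inequality
  obtain ⟨B, hB⟩ : ∃ B, ∀ n, r n ≤ B := by
    -- Testing with `ξ = ν`, where the divergence vanishes, and `|f n| ≤ r n * D` gives `N (r n) ≤ 2
    -- D r n - c + e n`. The conjugacy inequality at `w = 2 D + 1` then leaves exactly one `r n` to
    -- be bounded.
    refine ⟨lam * (2 * D + 1) ^ α - (c - 1), fun n => ?_⟩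
    have h1 := hf n ν
    rw [fDiv_self hφ.map_one, ← EReal.coe_zero, EReal.coe_le_coe_iff] at h1
    have hub : ∀ x, f n x ≤ r n * D := fun x => by
      have := hflip n x x₀
      rw [hf0] at this
      linarith [mul_le_mul_of_nonneg_left (hD x x₀) (hr0 n)]
    have hlb : ∀ x, -(r n * D) ≤ f n x := fun x => by
      have := hflip n x₀ x
      rw [hf0] at this
      linarith [mul_le_mul_of_nonneg_left (hD x₀ x) (hr0 n)]
    have h2 := integral_mono (hint n μ) (integrable_const _) hub
    have h3 := integral_mono (integrable_const _) (hint n ν) hlb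
    simp only [integral_const, probReal_univ, one_smul] at h2 h3
    have h4 := hN.young _ (hr n) (2 * D + 1) (by linarith)
    linarith [he1 n]
  have hB0 : 0 ≤ B := (hr0 0).trans (hB 0)
  let A : Set (BoundedContinuousFunction X ℝ) :=
    {g | g x₀ = 0 ∧ ∀ x y, g x - g y ≤ B * dist x y}
  have hA : IsCompact A := by
    refine BoundedContinuousFunction.arzela_ascoli₂ (Set.Icc (-(B * D)) (B * D)) isCompact_Icc A
      ?_ ?_ ?_
    · have : A = {g | g x₀ = 0} ∩ ⋂ x, ⋂ y, {g | g x - g y ≤ B * dist x y} := by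
        ext g; simp [A]
      rw [this]
      refine (isClosed_eq (continuous_eval_const x₀)
        continuous_const).inter (isClosed_iInter fun x => isClosed_iInter fun y => isClosed_le
          ((continuous_eval_const x).sub
            (continuous_eval_const y)) continuous_const)
    · rintro g x ⟨h0, h⟩
      have h1 := h x x₀
      have h2 := h x₀ x
      have h3 := mul_le_mul_of_nonneg_left (hD x x₀) hB0
      have h4 := mul_le_mul_of_nonneg_left (hD x₀ x) hB0
      constructor <;> linarith
    · refine LipschitzWith.uniformEquicontinuous _ B.toNNReal (fun g => ?_) |>.equicontinuous
      refine LipschitzWith.of_le_add_mul _ fun x y => ?_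
      rw [Real.coe_toNNReal _ hB0]
      linarith [g.2.2 x y]
  let F : ℕ → BoundedContinuousFunction X ℝ := fun n =>
    BoundedContinuousFunction.mkOfCompact ⟨f n, hcont n⟩
  have hF : ∀ n x, F n x = f n x := fun n x => rfl
  -- Functions and slopes converge along a common subsequence, which keeps the Lipschitz bound with
  -- the limit slope `s`.
  obtain ⟨⟨g, s⟩, ⟨hg, hs⟩, ψ, hψ, hlim⟩ :=
    (hA.prod ((isCompact_Icc (a := 0) (b := B)).inter_right hN.isClosed)).tendsto_subseq
      (x := fun n => (F n, r n)) fun n => ⟨⟨hf0 n, fun x y => (hflip n x y).trans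
        (mul_le_mul_of_nonneg_right (hB n) dist_nonneg)⟩, ⟨hr0 n, hB n⟩, hr n⟩
  have hlimF : Tendsto (fun n => F (ψ n)) atTop (nhds g) :=
    (continuous_fst.tendsto _).comp hlim
  have hlimr : Tendsto (fun n => r (ψ n)) atTop (nhds s) :=
    (continuous_snd.tendsto _).comp hlim
  have hlimx : ∀ x, Tendsto (fun n => f (ψ n) x) atTop (nhds (g x)) := fun x =>
    ((continuous_eval_const x).tendsto g).comp hlimF
  have hlimI : ∀ ξ : ProbabilityMeasure X, Tendsto (fun n => ∫ x, f (ψ n) x ∂(ξ : Measure X)) atTop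
      (nhds (∫ x, g x ∂(ξ : Measure X))) := fun ξ =>
    ((continuous_integral_boundedContinuousFunction_left (ξ : Measure X)).tendsto g).comp hlimF
  have hlimN : Tendsto (fun n => N (r (ψ n))) atTop (nhds (N s)) :=
    (hN.continuousOn s hs.2).tendsto.comp
      (tendsto_nhdsWithin_iff.2 ⟨hlimr, Eventually.of_forall fun n => hr _⟩)
  have hlime : Tendsto (fun n => c - e (ψ n)) atTop (nhds c) := by
    have := (tendsto_const_nhds (x := c)).sub
      ((tendsto_one_div_add_atTop_nhds_zero_nat (𝕜 := ℝ)).comp hψ.tendsto_atTop)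
    simpa [e] using this
  refine ⟨s, hs.2, g, fun x y => ?_, hg.1, fun ξ => ?_⟩
  · exact le_of_tendsto_of_tendsto' ((hlimx x).sub (hlimx y)) (hlimr.mul_const _)
      fun n => hflip _ x y
  · refine le_of_tendsto' ((continuous_coe_real_ereal.tendsto _).comp
      ((hlime.add ((hlimI ξ).sub (hlimI μ))).add hlimN)) fun n => hf _ ξ

/-! ### Optimal couplings, the primal minimiser and weak duality. -/

theorem coe_lintegral_edist (π : Measure (X × X)) [IsFiniteMeasure π] :
    ∫⁻ z, edist z.1 z.2 ∂π = ENNReal.ofReal (transportCost π) := by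
  refine Eq.trans (lintegral_congr fun z => edist_dist _ _) (ofReal_integral_eq_lintegral_ofReal
    ((distMap X).integrable_of_compactSpace π) (Eventually.of_forall fun _ => dist_nonneg)).symm

theorem continuous_transportCost :
    Continuous fun π : ProbabilityMeasure (X × X) => transportCost (π : Measure (X × X)) :=
  ProbabilityMeasure.continuous_integral_continuousMap (distMap X)

/-- An optimal coupling exists. -/
theorem exists_optimal_coupling (μ ξ : ProbabilityMeasure X) :
    ∃ π : ProbabilityMeasure (X × X), (π : Measure (X × X)).map Prod.fst = μ ∧
      (π : Measure (X × X)).map Prod.snd = ξ ∧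
      W₁ (μ : Measure X) (ξ : Measure X)
        = ENNReal.ofReal (transportCost (π : Measure (X × X))) := by
  let S := {π : ProbabilityMeasure (X × X) | (π : Measure (X × X)).map Prod.fst = μ} ∩
    {π | (π : Measure (X × X)).map Prod.snd = ξ}
  have hS : IsCompact S := ((isClosed_setOf_map_eq continuous_fst μ).inter
    (isClosed_setOf_map_eq continuous_snd ξ)).isCompact
  have hne : S.Nonempty := ⟨⟨(μ : Measure X).prod (ξ : Measure X), inferInstance⟩,
    Measure.map_fst_prod.trans (by simp), Measure.map_snd_prod.trans (by simp)⟩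
  obtain ⟨π, hπ, hmin⟩ := hS.exists_isMinOn hne continuous_transportCost.continuousOn
  refine ⟨π, hπ.1, hπ.2, le_antisymm ?_ ?_⟩
  · rw [← coe_lintegral_edist]
    exact iInf₂_le _ ⟨hπ.1, hπ.2⟩
  · refine le_iInf₂ fun π' hπ' => ?_
    have hp : IsProbabilityMeasure π' := ⟨by
      have : π'.map Prod.fst Set.univ = 1 := by rw [hπ'.1]; exact measure_univ
      rwa [Measure.map_apply measurable_fst MeasurableSet.univ, Set.preimage_univ] at this⟩
    rw [coe_lintegral_edist]
    exact ENNReal.ofReal_le_ofReal (hmin (a := ⟨π', hp⟩) ⟨hπ'.1, hπ'.2⟩)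

theorem coe_ofReal_mul_rpow {lam α w : ℝ} (hlam : 0 ≤ lam) (hα : 0 ≤ α) (hw : 0 ≤ w) :
    ((ENNReal.ofReal lam * ENNReal.ofReal w ^ α : ℝ≥0∞) : EReal) = ((lam * w ^ α : ℝ) : EReal) := by
  rw [ENNReal.ofReal_rpow_of_nonneg hw hα, ← ENNReal.ofReal_mul hlam, EReal.coe_ennreal_ofReal,
    max_eq_left (mul_nonneg hlam (Real.rpow_nonneg hw α))]

theorem exists_coupling_primalObjective_eq (φ : ℝ → EReal) {lam α : ℝ} (hlam : 0 ≤ lam)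
    (hα : 0 ≤ α) (μ ξ : ProbabilityMeasure X) (ν : Measure X) :
    ∃ π : ProbabilityMeasure (X × X), (π : Measure (X × X)).map Prod.fst = μ ∧
      (π : Measure (X × X)).map Prod.snd = ξ ∧
      primalObjective φ lam α (μ : Measure X) ν ξ = fDiv φ (ξ : Measure X) ν
        + ((lam * transportCost (π : Measure (X × X)) ^ α : ℝ) : EReal) := by
  obtain ⟨π, h1, h2, hW⟩ := exists_optimal_coupling μ ξ
  refine ⟨π, h1, h2, ?_⟩
  rw [primalObjective, hW, coe_ofReal_mul_rpow hlam hα (transportCost_nonneg _)]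

/-- The primal problem has a solution, with a finite value that bounds the transport functional
from below. -/
theorem IsAdmissible.exists_primal_minimizer {φ : ℝ → EReal} (hφ : IsAdmissible φ)
    {lam α : ℝ} (hlam : 0 ≤ lam) (hα : 0 ≤ α) (μ ν : ProbabilityMeasure X) :
    ∃ c : ℝ, IsLeast (Set.range (primalObjective φ lam α (μ : Measure X) (ν : Measure X)))
        (c : EReal) ∧
      ∀ π : ProbabilityMeasure (X × X), (π : Measure (X × X)).map Prod.fst = μ →
        (c : EReal) ≤ fDiv φ ((π : Measure (X × X)).map Prod.snd) (ν : Measure X)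
          + ((lam * transportCost (π : Measure (X × X)) ^ α : ℝ) : EReal) := by
  have : Nonempty X := μ.nonempty
  let G : ProbabilityMeasure (X × X) → EReal := fun π =>
    fDiv φ ((π : Measure (X × X)).map Prod.snd) (ν : Measure X)
      + ((lam * transportCost (π : Measure (X × X)) ^ α : ℝ) : EReal)
  have hG : LowerSemicontinuous G := by
    have h1 : LowerSemicontinuous fun π : ProbabilityMeasure (X × X) =>
        fDiv φ ((π : Measure (X × X)).map Prod.snd) (ν : Measure X) := by
      simpa only [Function.comp_def, ProbabilityMeasure.toMeasure_map] using
        (hφ.lowerSemicontinuous_fDiv (ν : Measure X)).comp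
          (ProbabilityMeasure.continuous_map (Ω := X × X) continuous_snd)
    have h2 : LowerSemicontinuous fun π : ProbabilityMeasure (X × X) =>
        ((lam * transportCost (π : Measure (X × X)) ^ α : ℝ) : EReal) :=
      (continuous_coe_real_ereal.comp (continuous_const.mul
        (continuous_transportCost.rpow_const fun _ => Or.inr hα))).lowerSemicontinuous
    exact h1.add' h2 fun π => EReal.continuousAt_add (Or.inr (EReal.coe_ne_bot _))
      (Or.inr (EReal.coe_ne_top _))
  obtain ⟨π₀, h1, h2, h3⟩ := exists_coupling_primalObjective_eq φ hlam hα μ ν (ν : Measure X)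
  -- Minimising over `π` with free second marginal treats the choice of `ξ` and of its coupling with
  -- `μ` at once.
  obtain ⟨π, hπ, hmin⟩ := LowerSemicontinuousOn.exists_isMinOn
    (s := {π : ProbabilityMeasure (X × X) | (π : Measure (X × X)).map Prod.fst = μ})
    ⟨π₀, h1⟩ (isClosed_setOf_map_eq (X := X × X) continuous_fst μ).isCompact
    (hG.lowerSemicontinuousOn _)
  have hbot : G π ≠ ⊥ := by
    have : IsFiniteMeasure ((π : Measure (X × X)).map Prod.snd) := inferInstance
    simp only [G, ne_eq, EReal.add_eq_bot_iff, not_or]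
    exact ⟨hφ.fDiv_ne_bot _ _, EReal.coe_ne_bot _⟩
  have htop : G π ≠ ⊤ := by
    refine ((hmin (a := π₀) h1).trans_lt ?_).ne
    simp only [G, h2, fDiv_self hφ.map_one, zero_add]
    exact EReal.coe_lt_top _
  have hle : ∀ ξ, G π ≤ primalObjective φ lam α (μ : Measure X) (ν : Measure X) ξ := fun ξ => by
    obtain ⟨π', h1, h2, h3⟩ := exists_coupling_primalObjective_eq φ hlam hα μ ξ (ν : Measure X)
    rw [h3, ← h2]
    exact hmin h1
  refine ⟨(G π).toReal, ?_, ?_⟩ <;> rw [EReal.coe_toReal htop hbot]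
  -- The second marginal of the minimising `π` solves the primal problem, as `π` is itself a
  -- competitor in `W₁`.
  · refine ⟨⟨π.map measurable_snd.aemeasurable, le_antisymm ?_ (hle _)⟩, ?_⟩
    · rw [primalObjective, ProbabilityMeasure.toMeasure_map]
      refine add_le_add le_rfl ?_
      rw [← coe_ofReal_mul_rpow hlam hα (transportCost_nonneg _)]
      refine EReal.coe_ennreal_le_coe_ennreal_iff.2 (mul_le_mul_right
        (ENNReal.rpow_le_rpow ?_ hα) _)
      rw [← coe_lintegral_edist]
      exact iInf₂_le _ ⟨hπ, rfl⟩
    · rintro _ ⟨ξ, rfl⟩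
      exact hle ξ
  · exact fun π' hπ' => hmin hπ'

theorem integral_sub_le_of_coupling {f : X → ℝ} {r : ℝ} (hr : 0 ≤ r)
    (hf : ∀ x y, f x - f y ≤ r * dist x y) {μ ξ : Measure X}
    {π : Measure (X × X)} [IsFiniteMeasure π]
    (h1 : π.map Prod.fst = μ) (h2 : π.map Prod.snd = ξ) :
    ∫ x, f x ∂μ - ∫ x, f x ∂ξ ≤ r * transportCost π := by
  have hfc : Continuous f := by
    refine (LipschitzWith.of_le_add_mul r.toNNReal fun x y => ?_).continuous
    rw [Real.coe_toNNReal r hr]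
    linarith [hf x y]
  let F : C(X, ℝ) := ⟨f, hfc⟩
  have i1 : Integrable (fun z : X × X => f z.1) π :=
    (F.comp ContinuousMap.fst : C(X × X, ℝ)).integrable_of_compactSpace π
  have i2 : Integrable (fun z : X × X => f z.2) π :=
    (F.comp ContinuousMap.snd : C(X × X, ℝ)).integrable_of_compactSpace π
  rw [← h1, ← h2, integral_map measurable_fst.aemeasurable hfc.aestronglyMeasurable,
    integral_map measurable_snd.aemeasurable hfc.aestronglyMeasurable, ← integral_sub i1 i2,
    transportCost, ← integral_const_mul]
  exact integral_mono (i1.sub i2) (((distMap X).integrable_of_compactSpace π).const_mul r)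
    fun z => hf z.1 z.2

/-- Weak duality. -/
theorem IsConjugatePenalty.dual_le_primal {φ : ℝ → EReal} {lam α : ℝ} (hlam : 0 ≤ lam)
    (hα : 0 ≤ α) {R : Set ℝ} {N : ℝ → ℝ} (hN : IsConjugatePenalty lam α R N)
    (hφ : IsAdmissible φ)
    (μ ν ξ : ProbabilityMeasure X) {r : ℝ} (hr : r ∈ R) {f : X → ℝ}
    (hf : ∀ x y, f x - f y ≤ r * dist x y) :
    ((∫ x, f x ∂(μ : Measure X) : ℝ) : EReal) - fDivConj φ f (ν : Measure X) - ((N r : ℝ) : EReal)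
      ≤ primalObjective φ lam α (μ : Measure X) (ν : Measure X) ξ := by
  have : Nonempty X := μ.nonempty
  obtain ⟨π, h1, h2, h3⟩ := exists_coupling_primalObjective_eq φ hlam hα μ ξ (ν : Measure X)
  rw [h3]
  have hW := integral_sub_le_of_coupling (hN.nonneg r hr) hf h1 h2
  have hY := hN.young r hr _ (transportCost_nonneg (π : Measure (X × X)))
  have hconj : ((∫ x, f x ∂(ξ : Measure X) : ℝ) : EReal) - fDiv φ (ξ : Measure X) (ν : Measure X)
      ≤ fDivConj φ f (ν : Measure X) :=
    le_iSup (fun ξ : ProbabilityMeasure X => ((∫ x, f x ∂(ξ : Measure X) : ℝ) : EReal)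
      - fDiv φ (ξ : Measure X) (ν : Measure X)) ξ
  have hb := hφ.fDiv_ne_bot (ξ : Measure X) (ν : Measure X)
  induction hd : fDiv φ (ξ : Measure X) (ν : Measure X) with
  | bot => exact absurd hd hb
  | top => rw [EReal.top_add_coe]; exact le_top
  | coe d =>
    rw [hd, ← EReal.coe_sub] at hconj
    refine (EReal.sub_le_sub (EReal.sub_le_sub le_rfl hconj) le_rfl).trans ?_
    rw [← EReal.coe_sub, ← EReal.coe_sub, ← EReal.coe_add, EReal.coe_le_coe_iff]
    linarith

end

/-! ### The Lipschitz norm and the two penalties. -/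

section LipNorm

variable {X : Type*} [MetricSpace X] {f : X → ℝ}

theorem lipNorm_nonneg (f : X → ℝ) : 0 ≤ lipNorm f :=
  Real.sSup_nonneg (by rintro _ ⟨x, y, -, rfl⟩; positivity)

theorem sub_le_lipNorm_mul_dist {x₀ : X} (hf : f ∈ LipAt x₀) (x y : X) :
    f x - f y ≤ lipNorm f * dist x y := by
  obtain ⟨⟨K, hK⟩, -⟩ := hf
  rcases eq_or_ne x y with rfl | hxy
  · simp
  · have hpos : 0 < dist x y := dist_pos.2 hxy
    rw [← div_le_iff₀ hpos]
    refine (div_le_div_of_nonneg_right (le_abs_self _) hpos.le).trans (le_csSup ⟨K, ?_⟩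
      ⟨x, y, hxy, rfl⟩)
    rintro _ ⟨a, b, hab, rfl⟩
    rw [div_le_iff₀ (dist_pos.2 hab)]
    exact hK.dist_le_mul a b

theorem lipNorm_le {r : ℝ} (hr : 0 ≤ r) (hf : ∀ x y, f x - f y ≤ r * dist x y) :
    lipNorm f ≤ r := by
  refine Real.sSup_le ?_ hr
  rintro _ ⟨x, y, hxy, rfl⟩
  rw [div_le_iff₀ (dist_pos.2 hxy), abs_le]
  have := hf y x
  rw [dist_comm] at this
  exact ⟨by linarith, hf x y⟩

theorem mem_lipAt {x₀ : X} {r : ℝ} (hr : 0 ≤ r) (hf : ∀ x y, f x - f y ≤ r * dist x y)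
    (h0 : f x₀ = 0) : f ∈ LipAt x₀ := by
  refine ⟨⟨r.toNNReal, LipschitzWith.of_le_add_mul _ fun x y => ?_⟩, h0⟩
  rw [Real.coe_toNNReal r hr]
  linarith [hf x y]

end LipNorm

/-- A linear penalty needs only the slope `lam`, at no cost; this is where the constraint on the
Lipschitz norm comes from. -/
theorem isConjugatePenalty_one {lam : ℝ} (hlam : 0 ≤ lam) :
    IsConjugatePenalty lam 1 {lam} fun _ => 0 where
  isClosed := isClosed_singleton
  nonneg := by rintro _ rfl; exact hlam
  convexOn := convexOn_const 0 (convex_singleton lam)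
  continuousOn := continuousOn_const
  young := by rintro _ rfl w -; simp
  exists_eq w _ := ⟨lam, rfl, by simp⟩

/-- Young's inequality for the exponents `α` and `α / (α - 1)`, rescaled so that the first term is
`lam * w ^ α`. -/
theorem isConjugatePenalty_of_one_lt {lam α : ℝ} (hlam : 0 < lam) (hα : 1 < α) :
    IsConjugatePenalty lam α (Set.Ici 0) fun r =>
      (α - 1) * α ^ (α / (1 - α)) * lam ^ (1 / (1 - α)) * r ^ (α / (α - 1)) := by
  have hα0 : 0 < α := by linarith
  have hα1 : 0 < α - 1 := by linarith
  have hα1' : 1 - α ≠ 0 := by linarith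
  have hq : 1 ≤ α / (α - 1) := by rw [le_div_iff₀ hα1]; linarith
  have hκ : 0 ≤ (α - 1) * α ^ (α / (1 - α)) * lam ^ (1 / (1 - α)) := by positivity
  -- the coefficient is that of the scaled Young inequality
  have hcoef : (α - 1) * α ^ (α / (1 - α)) * lam ^ (1 / (1 - α))
      = (((lam * α) ^ (-(1 / α))) ^ (α / (α - 1))) / (α / (α - 1)) := by
    have e1 : -(1 / α) * (α / (α - 1)) = 1 / (1 - α) := by
      rw [show 1 - α = -(α - 1) by ring]; field_simp
    have e2 : α / (1 - α) = 1 / (1 - α) - 1 := by field_simp; ring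
    rw [← Real.rpow_mul (by positivity), e1, Real.mul_rpow hlam.le hα0.le, e2,
      Real.rpow_sub hα0, Real.rpow_one]
    field_simp
  refine ⟨isClosed_Ici, fun r hr => hr, ?_, ?_, ?_, ?_⟩
  · exact (convexOn_rpow hq).smul hκ
  · exact (continuous_const.mul (Real.continuous_rpow_const (by linarith))).continuousOn
  · intro r hr w hw
    have hr : 0 ≤ r := hr
    have hpq : α.HolderConjugate (α / (α - 1)) := Real.HolderConjugate.conjExponent hα
    have hY := Real.young_inequality_of_nonneg (a := w * (lam * α) ^ (1 / α))
      (b := r * (lam * α) ^ (-(1 / α))) (by positivity) (by positivity) hpq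
    have h1 : w * (lam * α) ^ (1 / α) * (r * (lam * α) ^ (-(1 / α))) = r * w := by
      have : (lam * α) ^ (1 / α) * (lam * α) ^ (-(1 / α)) = 1 := by
        rw [← Real.rpow_add (by positivity), add_neg_cancel, Real.rpow_zero]
      linear_combination (r * w) * this
    have h2 : (w * (lam * α) ^ (1 / α)) ^ α / α = lam * w ^ α := by
      rw [Real.mul_rpow hw (by positivity), ← Real.rpow_mul (by positivity),
        one_div_mul_cancel hα0.ne', Real.rpow_one]
      field_simp
    have h3 : (r * (lam * α) ^ (-(1 / α))) ^ (α / (α - 1)) / (α / (α - 1))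
        = (α - 1) * α ^ (α / (1 - α)) * lam ^ (1 / (1 - α)) * r ^ (α / (α - 1)) := by
      rw [hcoef, Real.mul_rpow hr (by positivity)]
      ring
    rw [h1, h2, h3] at hY
    linarith
  · intro w hw
    -- Equality holds when `r` is the derivative of `lam * w ^ α`.
    refine ⟨lam * α * w ^ (α - 1), by simp only [Set.mem_Ici]; positivity, ?_⟩
    have h1 : lam * α * w ^ (α - 1) * w = lam * α * w ^ α := by
      rcases hw.eq_or_lt with rfl | hw
      · rw [Real.zero_rpow hα0.ne']; simp
      · rw [Real.rpow_sub_one hw.ne']; field_simp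
    have h2 : (α - 1) * α ^ (α / (1 - α)) * lam ^ (1 / (1 - α))
        * (lam * α * w ^ (α - 1)) ^ (α / (α - 1)) = (α - 1) * lam * w ^ α := by
      have e1 : (w ^ (α - 1)) ^ (α / (α - 1)) = w ^ α := by
        rw [← Real.rpow_mul hw, mul_div_cancel₀ _ hα1.ne']
      have e2 : α ^ (α / (1 - α)) * α ^ (α / (α - 1)) = 1 := by
        rw [← Real.rpow_add hα0, show α / (1 - α) + α / (α - 1) = 0 by
          rw [show 1 - α = -(α - 1) by ring, div_neg]; ring, Real.rpow_zero]
      have e3 : lam ^ (1 / (1 - α)) * lam ^ (α / (α - 1)) = lam := by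
        rw [← Real.rpow_add hlam, show 1 / (1 - α) + α / (α - 1) = 1 by
          rw [show 1 - α = -(α - 1) by ring, div_neg]; field_simp; ring, Real.rpow_one]
      rw [Real.mul_rpow (by positivity) (by positivity), Real.mul_rpow hlam.le hα0.le, e1]
      linear_combination ((α - 1) * w ^ α * lam ^ (1 / (1 - α)) * lam ^ (α / (α - 1))) * e2
        + ((α - 1) * w ^ α) * e3
    rw [h1]
    simp only [h2]
    ring

end MoreauYosida
end

/-! ### The duality theorem. -/

theorem proposition3 {X : Type*} [MetricSpace X] [CompactSpace X] [MeasurableSpace X]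
    [BorelSpace X] (x₀ : X) (μ ν : ProbabilityMeasure X) (lam α : ℝ) (hlam : 0 < lam)
    (hα : 1 ≤ α) (φ : ℝ → EReal) (hφ : MoreauYosida.IsAdmissible φ) :
    -- the infimum that defines `D_{φ,λ,α}(μ‖ν)` is a minimum
    IsLeast (Set.range (MoreauYosida.primalObjective φ lam α (μ : Measure X) (ν : Measure X)))
      (MoreauYosida.myDiv φ lam α (μ : Measure X) (ν : Measure X)) ∧
    -- the case `α = 1`
    (α = 1 →
      IsGreatest
        ((fun f : X → ℝ => ((∫ x, f x ∂(μ : Measure X) : ℝ) : EReal)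
            - MoreauYosida.fDivConj φ f (ν : Measure X)) ''
          {f | f ∈ MoreauYosida.LipAt x₀ ∧ MoreauYosida.lipNorm f ≤ lam})
        (MoreauYosida.myDiv φ lam α (μ : Measure X) (ν : Measure X))) ∧
    -- the case `α > 1`
    (1 < α →
      IsGreatest
        ((fun f : X → ℝ => ((∫ x, f x ∂(μ : Measure X) : ℝ) : EReal)
            - MoreauYosida.fDivConj φ f (ν : Measure X)
            - (((α - 1) * α ^ (α / (1 - α)) * lam ^ (1 / (1 - α))
                * MoreauYosida.lipNorm f ^ (α / (α - 1)) : ℝ) : EReal)) ''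
          MoreauYosida.LipAt x₀)
        (MoreauYosida.myDiv φ lam α (μ : Measure X) (ν : Measure X))) := by
  have hα0 : 0 ≤ α := by linarith
  obtain ⟨c, hc, hcπ⟩ := hφ.exists_primal_minimizer hlam.le hα0 μ ν
  have hmy : MoreauYosida.myDiv φ lam α (μ : Measure X) (ν : Measure X) = c := hc.isGLB.sInf_eq
  obtain ⟨ξ, hξ⟩ := hc.1
  rw [hmy]
  refine ⟨hc, ?_, fun hα1 => ?_⟩
  · rintro rfl
    have hN := MoreauYosida.isConjugatePenalty_one hlam.le
    have hle : ∀ f ∈ {f | f ∈ MoreauYosida.LipAt x₀ ∧ MoreauYosida.lipNorm f ≤ lam},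
        ((∫ x, f x ∂(μ : Measure X) : ℝ) : EReal) - MoreauYosida.fDivConj φ f (ν : Measure X)
          ≤ c := by
      rintro f ⟨hf, hfl⟩
      have := hN.dual_le_primal hlam.le hα0 hφ μ ν ξ (Set.mem_singleton lam) (f := f) fun x y =>
        (MoreauYosida.sub_le_lipNorm_mul_dist hf x y).trans
          (mul_le_mul_of_nonneg_right hfl dist_nonneg)
      rwa [EReal.coe_zero, sub_zero, hξ] at this
    obtain ⟨r, hr, f, hf, hf0, hfξ⟩ := hφ.exists_lipschitz_of_forall_le hN x₀ μ ν hcπ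
    obtain rfl : r = lam := hr
    have hmem : f ∈ {f | f ∈ MoreauYosida.LipAt x₀ ∧ MoreauYosida.lipNorm f ≤ r} :=
      ⟨MoreauYosida.mem_lipAt hlam.le hf hf0, MoreauYosida.lipNorm_le hlam.le hf⟩
    refine ⟨⟨f, hmem, le_antisymm (hle f hmem) ?_⟩, ?_⟩
    · have := MoreauYosida.le_dual_of_forall_le hfξ
      rwa [EReal.coe_zero, sub_zero] at this
    · rintro _ ⟨f, hf, rfl⟩
      exact hle f hf
  · have hN := MoreauYosida.isConjugatePenalty_of_one_lt hlam hα1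
    have hle : ∀ f ∈ MoreauYosida.LipAt x₀,
        ((∫ x, f x ∂(μ : Measure X) : ℝ) : EReal) - MoreauYosida.fDivConj φ f (ν : Measure X)
          - (((α - 1) * α ^ (α / (1 - α)) * lam ^ (1 / (1 - α))
            * MoreauYosida.lipNorm f ^ (α / (α - 1)) : ℝ) : EReal) ≤ c := fun f hf =>
      (hN.dual_le_primal hlam.le hα0 hφ μ ν ξ (MoreauYosida.lipNorm_nonneg f)
        (MoreauYosida.sub_le_lipNorm_mul_dist hf)).trans hξ.le
    obtain ⟨r, hr, f, hf, hf0, hfξ⟩ := hφ.exists_lipschitz_of_forall_le hN x₀ μ ν hcπ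
    have hmem := MoreauYosida.mem_lipAt hr hf hf0
    refine ⟨⟨f, hmem, le_antisymm (hle f hmem) ?_⟩, ?_⟩
    -- The slope `r` need only bound the Lipschitz norm of `f`; since the penalty is increasing,
    -- passing to the norm can only raise the dual value.
    · refine (MoreauYosida.le_dual_of_forall_le hfξ).trans (EReal.sub_le_sub le_rfl
        (EReal.coe_le_coe_iff.2 (mul_le_mul_of_nonneg_left ?_ ?_)))
      · exact Real.rpow_le_rpow (MoreauYosida.lipNorm_nonneg f) (MoreauYosida.lipNorm_le hr hf)
          (div_nonneg hα0 (by linarith))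
      · have : 0 < α - 1 := by linarith
        positivity
    · rintro _ ⟨f, hf, rfl⟩
      exact hle f hf
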